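/- Let $\epsilon=(\epsilon_n)_{n\ge 1}$ be a polynomially small family, that is, $\epsilon_n>0$ for all $n$ and $1/\epsilon_n=O(p(n))$ for some polynomial $p$. Then the restricted quantum computer $\mathrm{QC}_\epsilon$ can solve every problem in BQP in polynomial time. Here $\mathrm{QC}_\epsilon$ is the computer that runs only those circuits of elementary unitary gates, each acting on at most three qubits (with matrix entries in $\mathbb{Q}(e^{i\pi/4})$, given explicitly by rational coordinates whose numerators and denominators are written in unary), for which the following holds: if the circuit acts on an $n$-qubit register, $n\ge 1$, with input $|0\rangle^n$, then at every step of the computation (before the first gate and after each gate) the state $|\psi\rangle$ of the register satisfies $T(|\psi\rangle,|0\rangle^n)\le\epsilon_n$, where $T(|\psi\rangle,|\varphi\rangle)=\tfrac12\big\|\,|\psi\rangle\langle\psi|-|\varphi\rangle\langle\varphi|\,\big\|_1$ is the trace distance. A run ends with a standard basis measurement of the first qubit. A decision problem, possibly with a promise, is given by sets of yes-instances and no-instances in $\{0,1\}^*$ (a language and its complement in the case without promise). It is in BQP if a deterministic Turing machine computes in polynomial time, from each $x\in\{0,1\}^*$, a circuit of Hadamard, $\pi/8$-phase and CNOT gates,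 to be run on $|0\rangle^m$ for some $m\ge 1$, such that the measurement of the first qubit at the end gives $1$ with probability at least $2/3$ if $x$ is a yes-instance and at most $1/3$ if $x$ is a no-instance. It is solved by $\mathrm{QC}_\epsilon$ in polynomial time if there are polynomials $s,r$ and polynomial-time deterministic Turing machines $A,B$ such that, for each $x$, the machine $A$ computes from $x$ the description of a circuit that $\mathrm{QC}_\epsilon$ is allowed to run, with at most $s(n)$ gates if it has $n$ qubits; and such that $B$, given $x$ and the outcomes of $r(|x|)$ independent runs of this circuit, accepts with probability at least $2/3$ if $x$ is a yes-instance and at most $1/3$ if $x$ is a no-instance. -/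

import Mathlib

open Asymptotics Filter

noncomputable section

namespace SmallQC

/-! ### Pure states and elementary gates -/

/-- Amplitudes of a pure state of `n` qubits in the standard basis. -/
abbrev State (n : ℕ) : Type := (Fin n → Bool) → ℂ

/-- Operators on `k` qubits, in the standard basis. -/
abbrev QubitMatrix (k : ℕ) : Type := Matrix (Fin k → Bool) (Fin k → Bool) ℂ

/-- The state `|0⟩^n`. -/
def zeroState (n : ℕ) : State n := Pi.single (fun _ => false) 1

/-- An elementary unitary gate in an `n`-qubit register: a unitary on at most three qubits,
together with the distinct qubits on which it acts. -/
structure Gate (n : ℕ) where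
  arity : ℕ
  arity_le : arity ≤ 3
  wires : Fin arity ↪ Fin n
  mat : QubitMatrix arity
  unitary : mat ∈ Matrix.unitaryGroup (Fin arity → Bool) ℂ

/-- The action of a gate on the register (identity on the qubits that are not wires of the gate):
`Function.extend g.wires y x` is the bit string `x` with the bits on the wires replaced by `y`. -/
def Gate.apply {n : ℕ} (g : Gate n) (ψ : State n) : State n := fun x =>
  ∑ y : Fin g.arity → Bool, g.mat (x ∘ g.wires) y * ψ (Function.extend g.wires y x)

/-- The state obtained from `|0⟩^n` by applying the gates of the list from left to right. -/
def finalState {n : ℕ} (gs : List (Gate n)) : State n :=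
  gs.foldl (fun ψ g => g.apply ψ) (zeroState n)

/-- Probability of the outcome `1` when qubit `i` is measured in the standard basis. -/
def probOne {n : ℕ} (ψ : State n) (i : Fin n) : ℝ :=
  ∑ x : Fin n → Bool, if x i then ‖ψ x‖ ^ 2 else 0

/-! ### Trace distance and the neighbourhood of `|0⟩^n` -/

/-- The trace norm: the sum of the singular values, which are the square roots of the eigenvalues
of `Aᴴ * A`. -/
def traceNorm {ι : Type} [Fintype ι] [DecidableEq ι] (A : Matrix ι ι ℂ) : ℝ :=
  ∑ i, Real.sqrt ((Matrix.isHermitian_conjTranspose_mul_self A).eigenvalues i)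

/-- The density operator `|ψ⟩⟨ψ|`. -/
def density {n : ℕ} (ψ : State n) : QubitMatrix n := Matrix.vecMulVec ψ (star ψ)

/-- The trace distance of two pure states. -/
def traceDist {n : ℕ} (ψ φ : State n) : ℝ := (1 / 2) * traceNorm (density ψ - density φ)

/-- The set of `n`-qubit states that are `ε`-close to `|0⟩^n` in trace distance. -/
def nearZero (n : ℕ) (ε : ℝ) : Set (State n) :=
  {ψ | ∑ x, ‖ψ x‖ ^ 2 = 1 ∧ traceDist ψ (zeroState n) ≤ ε}

/-- `ε 1, ε 2, …` are positive and `1 / ε n = O(p n)` for some polynomial `p`. -/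
def PolynomiallySmall (ε : ℕ → ℝ) : Prop :=
  (∀ n, 1 ≤ n → 0 < ε n) ∧
    ∃ p : Polynomial ℝ, (fun n : ℕ => 1 / ε n) =O[atTop] fun n : ℕ => p.eval (n : ℝ)

/-! ### Gates and circuits with finite descriptions -/

/-- The Hadamard gate. -/
def hadamard : QubitMatrix 1 := fun x y =>
  (if x 0 && y 0 then -1 else 1) / ((Real.sqrt 2 : ℝ) : ℂ)

/-- The number `exp (i π / 4)`. -/
def zeta : ℂ := Complex.exp (((Real.pi / 4 : ℝ) : ℂ) * Complex.I)

/-- The `π / 8` phase gate `diag (1, exp (i π / 4))`. -/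
def phaseT : QubitMatrix 1 := Matrix.diagonal fun x => if x 0 then zeta else 1

/-- The CNOT gate; qubit `0` is the control, qubit `1` the target. -/
def cnot : QubitMatrix 2 := fun x y =>
  if x 0 = y 0 ∧ x 1 = xor (y 0) (y 1) then 1 else 0

/-- A letter of the universal gate set: a Hadamard, `π / 8` phase or CNOT gate on given qubits. -/
inductive StdGate (n : ℕ) : Type
  | h (i : Fin n)
  | t (i : Fin n)
  | cx (control target : Fin n) (ne : control ≠ target)

lemma hadamard_unitary : hadamard ∈ Matrix.unitaryGroup (Fin 1 → Bool) ℂ := by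
  have hs : ((Real.sqrt 2 : ℝ) : ℂ) * ((Real.sqrt 2 : ℝ) : ℂ) = 2 := by
    rw [← Complex.ofReal_mul, Real.mul_self_sqrt (by norm_num)]; norm_num
  have h0 : ((Real.sqrt 2 : ℝ) : ℂ) ≠ 0 := by
    intro h
    rw [h] at hs
    norm_num at hs
  rw [Matrix.mem_unitaryGroup_iff]
  ext x y
  rw [Matrix.mul_apply, ← (Equiv.funUnique (Fin 1) Bool).symm.sum_comp]
  have hxy : x = y ↔ x 0 = y 0 := by
    constructor
    · rintro rfl; rfl
    · intro h; funext i; rw [Subsingleton.elim i 0]; exact h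
  rw [Matrix.one_apply]
  simp only [hxy]
  cases hx : x 0 <;> cases hy : y 0 <;>
    simp [hadamard, hx, hy, Matrix.star_apply, Equiv.funUnique] <;> field_simp <;>
    first | done | (rw [pow_two, hs]; try norm_num)

lemma phaseT_unitary : phaseT ∈ Matrix.unitaryGroup (Fin 1 → Bool) ℂ := by
  have hz : zeta * star zeta = 1 := by
    rw [Complex.star_def, Complex.mul_conj, Complex.normSq_eq_norm_sq, zeta,
      Complex.norm_exp_ofReal_mul_I]
    norm_num
  rw [Matrix.mem_unitaryGroup_iff, Matrix.star_eq_conjTranspose, phaseT,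
    Matrix.diagonal_conjTranspose, Matrix.diagonal_mul_diagonal, ← Matrix.diagonal_one]
  congr 1
  funext x
  by_cases h : x 0 = true
  · simpa [h] using hz
  · simp [h]

lemma cnot_unitary : cnot ∈ Matrix.unitaryGroup (Fin 2 → Bool) ℂ := by
  rw [Matrix.mem_unitaryGroup_iff]
  ext x y
  rw [Matrix.mul_apply, ← (finTwoArrowEquiv Bool).symm.sum_comp, Fintype.sum_prod_type]
  have hxy : x = y ↔ x 0 = y 0 ∧ x 1 = y 1 := by
    constructor
    · rintro rfl; exact ⟨rfl, rfl⟩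
    · rintro ⟨h0, h1⟩; funext i; fin_cases i; exacts [h0, h1]
  rw [Matrix.one_apply]
  simp only [hxy]
  cases hx : x 0 <;> cases hx1 : x 1 <;> cases hy : y 0 <;> cases hy1 : y 1 <;>
    simp [cnot, hx, hy, hx1, hy1, Matrix.star_apply, finTwoArrowEquiv]

/-- One-qubit wire. -/
def wire1 {n : ℕ} (i : Fin n) : Fin 1 ↪ Fin n :=
  ⟨fun _ => i, fun a b _ => Subsingleton.elim a b⟩

/-- Two distinct wires. -/
def wire2 {n : ℕ} (i j : Fin n) (ne : i ≠ j) : Fin 2 ↪ Fin n :=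
  ⟨![i, j], by
    intro a b hab
    fin_cases a <;> fin_cases b <;> simp_all [eq_comm]⟩

/-- The gate denoted by a letter of the universal gate set. -/
def StdGate.toGate {n : ℕ} : StdGate n → Gate n
  | .h i => ⟨1, by norm_num, wire1 i, hadamard, hadamard_unitary⟩
  | .t i => ⟨1, by norm_num, wire1 i, phaseT, phaseT_unitary⟩
  | .cx c d ne => ⟨2, by norm_num, wire2 c d ne, cnot, cnot_unitary⟩

/-- The element `c₀ + c₁ ζ + c₂ ζ² + c₃ ζ³` of the field `ℚ(ζ)`, `ζ = exp (i π / 4)`. -/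
def cyclo (c : Fin 4 → ℚ) : ℂ := ∑ j : Fin 4, (c j : ℂ) * zeta ^ (j : ℕ)

/-- A unitary gate on at most three qubits, given explicitly by its matrix, whose entries are in
the field `ℚ(exp (i π / 4))`. -/
structure ExactGate (n : ℕ) where
  arity : ℕ
  arity_le : arity ≤ 3
  wires : Fin arity ↪ Fin n
  coeff : (Fin arity → Bool) → (Fin arity → Bool) → Fin 4 → ℚ
  unitary : (Matrix.of fun x y => cyclo (coeff x y)) ∈
    Matrix.unitaryGroup (Fin arity → Bool) ℂ

/-- The gate denoted by an exact description. -/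
def ExactGate.toGate {n : ℕ} (g : ExactGate n) : Gate n :=
  ⟨g.arity, g.arity_le, g.wires, Matrix.of fun x y => cyclo (g.coeff x y), g.unitary⟩

/-- A circuit on a register of at least one qubit, with gates described by `G`. -/
structure Circuit (G : ℕ → Type) where
  numQubits : ℕ
  pos : 0 < numQubits
  gates : List (G numQubits)

/-! ### Circuits as bit strings -/

/-- Self-delimiting unary code of a natural number. -/
def codeNat (a : ℕ) : List Bool := List.replicate a true ++ [false]

/-- Self-delimiting code of a rational number: sign, numerator, denominator. -/
def codeRat (r : ℚ) : List Bool :=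
  decide (r < 0) :: (codeNat r.num.natAbs ++ codeNat r.den)

/-- All bit strings of length `k`, in the order of the binary numbers. -/
def bitStrings (k : ℕ) : List (Fin k → Bool) :=
  (List.range (2 ^ k)).map fun j i => j.testBit i

/-- Code of a letter of the universal gate set. -/
def StdGate.code {n : ℕ} : StdGate n → List Bool
  | .h i => codeNat 0 ++ codeNat i
  | .t i => codeNat 1 ++ codeNat i
  | .cx c d _ => codeNat 2 ++ codeNat c ++ codeNat d

/-- Code of an exactly described gate: the arity, the wires, and the matrix entries. -/
def ExactGate.code {n : ℕ} (g : ExactGate n) : List Bool :=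
  codeNat g.arity ++ (List.ofFn fun i => (g.wires i : ℕ)).flatMap codeNat ++
    (bitStrings g.arity).flatMap fun x => (bitStrings g.arity).flatMap fun y =>
      (List.ofFn (g.coeff x y)).flatMap codeRat

/-- Code of a circuit: the number of qubits in unary, then the gates in their order. -/
def Circuit.code {G : ℕ → Type} (gc : ∀ n, G n → List Bool) (C : Circuit G) : List Bool :=
  codeNat C.numQubits ++ C.gates.flatMap (fun g => true :: gc C.numQubits g) ++ [false]

/-- Code of an input string together with a list of measurement outcomes. -/
def codePair (p : List Bool × List Bool) : List (Bool ⊕ Bool) :=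
  p.1.map Sum.inl ++ p.2.map Sum.inr

/-! ### BQP and the restricted quantum computer -/

/-- The probability that measuring the first qubit after the circuit, run on `|0⟩^n`, gives `1`. -/
def Circuit.accProb {G : ℕ → Type} (den : ∀ n, G n → Gate n) (C : Circuit G) : ℝ :=
  probOne (finalState (C.gates.map (den C.numQubits))) ⟨0, C.pos⟩

/-- The decision problem with yes-instances `yes` and no-instances `no` is in BQP: some
deterministic Turing machine computes in polynomial time from every input `x` a
Hadamard, `π / 8`, CNOT circuit which accepts with probability at least `2 / 3` if `x ∈ yes` and
at most `1 / 3` if `x ∈ no`. A language `L` is the case `yes = L`, `no = Lᶜ`. -/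
def InBQP (yes no : Set (List Bool)) : Prop :=
  ∃ circ : List Bool → Circuit StdGate,
    Nonempty (Turing.TM2ComputableInPolyTime (id : List Bool → List Bool)
      (Circuit.code fun _ g => g.code) circ) ∧
    (∀ x ∈ yes, 2 / 3 ≤ (circ x).accProb fun _ g => g.toGate) ∧
    (∀ x ∈ no, (circ x).accProb (fun _ g => g.toGate) ≤ 1 / 3)

/-- The circuits that the restricted quantum computer `QC_ε` may run: at every step of the
computation (before the first gate and after each gate) the state of the `n`-qubit register is
`ε n`-close to `|0⟩^n` in trace distance. -/
def QC (ε : ℕ → ℝ) : Set (Circuit ExactGate) :=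
  {C | ∀ t ≤ C.gates.length,
    finalState ((C.gates.take t).map ExactGate.toGate) ∈ nearZero C.numQubits (ε C.numQubits)}

/-- The probability that the sequence of outcomes of `N` independent runs, each of which gives `1`
with probability `q`, satisfies the test `post`. -/
def probRuns (q : ℝ) (N : ℕ) (post : List Bool → Bool) : ℝ :=
  ∑ o : Fin N → Bool,
    if post (List.ofFn o) then ∏ i, (if o i then q else 1 - q) else 0

/-- The decision problem `(yes, no)` can be solved with bounded error in polynomial time by an
algorithm with access to `QC_ε`: on input `x`, a deterministic Turing machine computes in
polynomial time a circuit that is allowed in `QC_ε` and has a number of gates polynomial in its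
number `n` of qubits, the circuit is run on `QC_ε` a number of times that is polynomial in the
length of `x`, each run followed by the measurement of the first qubit, and a deterministic Turing
machine computes the answer in polynomial time from `x` and the outcomes. -/
def SolvableByQC (ε : ℕ → ℝ) (yes no : Set (List Bool)) : Prop :=
  ∃ (circ : List Bool → Circuit ExactGate) (size runs : Polynomial ℕ)
    (post : List Bool × List Bool → Bool),
    Nonempty (Turing.TM2ComputableInPolyTime (id : List Bool → List Bool)
      (Circuit.code fun _ g => g.code) circ) ∧
    Nonempty (Turing.TM2ComputableInPolyTime codePair Computability.encodeBool post) ∧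
    (∀ x, circ x ∈ QC ε) ∧
    (∀ x, (circ x).gates.length ≤ size.eval (circ x).numQubits) ∧
    (∀ x ∈ yes, 2 / 3 ≤ probRuns ((circ x).accProb fun _ g => g.toGate)
      (runs.eval x.length) fun o => post (x, o)) ∧
    (∀ x ∈ no, probRuns ((circ x).accProb fun _ g => g.toGate)
      (runs.eval x.length) (fun o => post (x, o)) ≤ 1 / 3)

end SmallQC

end

/-!
Add one control qubit to a circuit of Hadamard, `π / 8` and CNOT gates, rotate it so that its
amplitude at `1` has square `1 / (N ^ 2 + 1)`, and control every gate of the circuit on it; the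
controlled gates act on at most three qubits. At every step the state is a superposition of
`|0 … 0⟩` and a state of weight `1 / (N ^ 2 + 1)`, so its trace distance to `|0 … 0⟩` is less than
`1 / N`, and the probability of measuring `1` is that of the original circuit divided by
`N ^ 2 + 1`. Hence `72 (N ^ 2 + 1)` runs give at least `48` ones on average for a yes-instance and
at most `24` for a no-instance, with variance at most the mean, and by Chebyshev's inequality a
count of `36` separates the two cases with error at most `1 / 3`.

As `1 / ε` is bounded by a polynomial, `N = (|x| + 2) ^ j` is large enough for some `j`. The
entries of the rotation are rational numbers with denominator `N ^ 2 + 1`, which a Turing machine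
writes in unary when it translates the circuit gate by gate.
-/

noncomputable section

namespace SmallQC

open Turing

/-! ### Polynomial bounds -/

section PolyBounded

variable {ι : Type*} {size f g : ι → ℕ}

/-- The quantity `f` is bounded by a polynomial in the quantity `size`. -/
def PolyBounded (size f : ι → ℕ) : Prop :=
  ∃ P : Polynomial ℕ, ∀ i, f i ≤ P.eval (size i)

lemma monotone_eval_nat (P : Polynomial ℕ) : Monotone fun n => P.eval n := fun a b h => by
  simp only [Polynomial.eval_eq_sum_range]
  gcongr

lemma exists_eval_le_pow (P : Polynomial ℕ) : ∃ j, ∀ n, P.eval n ≤ (n + 2) ^ j := by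
  induction P using Polynomial.induction_on' with
  | add p q hp hq =>
    obtain ⟨a, ha⟩ := hp
    obtain ⟨b, hb⟩ := hq
    refine ⟨max a b + 1, fun n => ?_⟩
    calc (p + q).eval n ≤ (n + 2) ^ max a b + (n + 2) ^ max a b := by
          rw [Polynomial.eval_add]
          exact Nat.add_le_add
            ((ha n).trans (Nat.pow_le_pow_right (by lia) (le_max_left a b)))
            ((hb n).trans (Nat.pow_le_pow_right (by lia) (le_max_right a b)))
      _ ≤ (n + 2) ^ (max a b + 1) := by rw [pow_succ]; nlinarith [Nat.zero_le ((n + 2) ^ max a b)]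
  | monomial k c =>
    refine ⟨c + k, fun n => ?_⟩
    rw [Polynomial.eval_monomial, pow_add]
    gcongr
    · exact Nat.lt_two_pow_self.le.trans (Nat.pow_le_pow_left (by lia) c)
    · lia

namespace PolyBounded

lemma exists_le_pow (hf : PolyBounded size f) : ∃ j, ∀ i, f i ≤ (size i + 2) ^ j := by
  obtain ⟨P, hP⟩ := hf
  obtain ⟨j, hj⟩ := exists_eval_le_pow P
  exact ⟨j, fun i => (hP i).trans (hj _)⟩

lemma self : PolyBounded size size := ⟨Polynomial.X, by simp⟩

lemma const (c : ℕ) : PolyBounded size fun _ => c := ⟨Polynomial.C c, by simp⟩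

lemma add (hf : PolyBounded size f) (hg : PolyBounded size g) :
    PolyBounded size fun i => f i + g i := by
  obtain ⟨P, hP⟩ := hf
  obtain ⟨Q, hQ⟩ := hg
  exact ⟨P + Q, fun i => by simpa using Nat.add_le_add (hP i) (hQ i)⟩

lemma mul (hf : PolyBounded size f) (hg : PolyBounded size g) :
    PolyBounded size fun i => f i * g i := by
  obtain ⟨P, hP⟩ := hf
  obtain ⟨Q, hQ⟩ := hg
  exact ⟨P * Q, fun i => by simpa using Nat.mul_le_mul (hP i) (hQ i)⟩

lemma pow (hf : PolyBounded size f) (k : ℕ) : PolyBounded size fun i => f i ^ k := by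
  obtain ⟨P, hP⟩ := hf
  exact ⟨P ^ k, fun i => by simpa using Nat.pow_le_pow_left (hP i) k⟩

lemma mono (hf : PolyBounded size f) (h : ∀ i, g i ≤ f i) : PolyBounded size g := by
  obtain ⟨P, hP⟩ := hf
  exact ⟨P, fun i => (h i).trans (hP i)⟩

lemma trans (hg : PolyBounded f g) (hf : PolyBounded size f) : PolyBounded size g := by
  obtain ⟨P, hP⟩ := hf
  obtain ⟨Q, hQ⟩ := hg
  exact ⟨Q.comp P, fun i => by
    simpa using (hQ i).trans (monotone_eval_nat Q (hP i))⟩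

end PolyBounded

end PolyBounded

/-! ### Runs of stack machines -/

section Steps

variable {K : Type} [DecidableEq K] {Γ : K → Type} {Λ σ : Type}

/-- `Steps m t c d`: the stack program `m` goes from `c` to `d` in exactly `t` steps. -/
inductive Steps (m : Λ → TM2.Stmt Γ Λ σ) : ℕ → TM2.Cfg Γ Λ σ → TM2.Cfg Γ Λ σ → Prop
  | refl (c) : Steps m 0 c c
  | head {t l v S d} : Steps m t (TM2.stepAux (m l) v S) d → Steps m (t + 1) ⟨some l, v, S⟩ d

variable {m : Λ → TM2.Stmt Γ Λ σ}

lemma Steps.trans {s t : ℕ} {a b c : TM2.Cfg Γ Λ σ} (hab : Steps m s a b)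
    (hbc : Steps m t b c) : Steps m (s + t) a c := by
  induction hab with
  | refl => simpa using hbc
  | head _ ih => rw [Nat.add_right_comm]; exact .head (ih hbc)

lemma Steps.single {l v S d} (h : TM2.stepAux (m l) v S = d) : Steps m 1 ⟨some l, v, S⟩ d :=
  .head (h ▸ .refl _)

lemma Steps.simulate {K' : Type} [DecidableEq K'] {Γ' : K' → Type} {Λ' σ' : Type}
    {m' : Λ' → TM2.Stmt Γ' Λ' σ'} (Φ : TM2.Cfg Γ Λ σ → TM2.Cfg Γ' Λ' σ')
    (hΦ : ∀ l v S, Steps m' 1 (Φ ⟨some l, v, S⟩) (Φ (TM2.stepAux (m l) v S)))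
    {t : ℕ} {c d : TM2.Cfg Γ Λ σ} (h : Steps m t c d) : Steps m' t (Φ c) (Φ d) := by
  induction h with
  | refl => exact .refl _
  | head _ ih => rw [Nat.add_comm]; exact (hΦ _ _ _).trans ih

lemma iterate_step_eq_some_iff {t : ℕ} {c d : TM2.Cfg Γ Λ σ} :
    (flip Bind.bind (TM2.step m))^[t] (some c) = some d ↔ Steps m t c d := by
  refine ⟨fun h => ?_, fun h => ?_⟩
  · induction t generalizing c with
    | zero =>
      obtain rfl : c = d := by simpa using h
      exact .refl c
    | succ t ih =>
      rw [Function.iterate_succ_apply] at h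
      obtain ⟨_ | l, v, S⟩ := c
      · have stuck : (flip Bind.bind (TM2.step m))^[t] none = none := Function.iterate_fixed rfl t
        exact absurd (stuck.symm.trans h) (by simp)
      · exact .head (ih h)
  · induction h with
    | refl => rfl
    | head _ ih => rw [Function.iterate_succ_apply]; exact ih

/-- Rename the labels of a statement by `f`, and replace halting by a jump to `e`
(or keep it, if `e = none`). -/
def relabel {Λ' : Type} (f : Λ → Λ') (e : Option Λ') : TM2.Stmt Γ Λ σ → TM2.Stmt Γ Λ' σ
  | .push k a q => .push k a (relabel f e q)
  | .peek k a q => .peek k a (relabel f e q)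
  | .pop k a q => .pop k a (relabel f e q)
  | .load a q => .load a (relabel f e q)
  | .branch p q₁ q₂ => .branch p (relabel f e q₁) (relabel f e q₂)
  | .goto g => .goto fun v => f (g v)
  | .halt => e.elim .halt fun l => .goto fun _ => l

lemma stepAux_relabel {Λ' : Type} (f : Λ → Λ') (e : Option Λ') (q : TM2.Stmt Γ Λ σ) (v : σ)
    (S : ∀ k, List (Γ k)) :
    TM2.stepAux (relabel f e q) v S =
      ⟨(TM2.stepAux q v S).l.elim e fun l => some (f l), (TM2.stepAux q v S).var,
        (TM2.stepAux q v S).stk⟩ := by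
  induction q generalizing v S with
  | push _ _ _ ih => exact ih _ _
  | peek _ _ _ ih => exact ih _ _
  | pop _ _ _ ih => exact ih _ _
  | load _ _ ih => exact ih _ _
  | branch p _ _ ih₁ ih₂ =>
    simp only [relabel, TM2.stepAux]
    cases p v
    · exact ih₂ _ _
    · exact ih₁ _ _
  | goto _ => rfl
  | halt => cases e <;> rfl

/-- A bound for the number of symbols that a statement puts on the stacks. -/
def pushes : TM2.Stmt Γ Λ σ → ℕ
  | .push _ _ q => pushes q + 1
  | .peek _ _ q => pushes q
  | .pop _ _ q => pushes q
  | .load _ q => pushes q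
  | .branch _ q₁ q₂ => pushes q₁ + pushes q₂
  | .goto _ => 0
  | .halt => 0

lemma length_stepAux_le (q : TM2.Stmt Γ Λ σ) (v : σ) (S : ∀ k, List (Γ k)) (k : K) :
    ((TM2.stepAux q v S).stk k).length ≤ (S k).length + pushes q := by
  induction q generalizing v S with
  | push k' _ _ ih =>
    refine (ih _ _).trans ?_
    by_cases h : k = k'
    · subst h; simp [pushes]; lia
    · simp [pushes, Function.update_of_ne h]
  | peek _ _ _ ih => exact ih _ _
  | pop k' _ _ ih =>
    refine (ih _ _).trans ?_
    by_cases h : k = k'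
    · subst h; simp [pushes]
    · simp [pushes, Function.update_of_ne h]
  | load _ _ ih => exact ih _ _
  | branch p _ _ ih₁ ih₂ =>
    simp only [TM2.stepAux, pushes]
    cases p v
    · exact (ih₂ _ _).trans (by lia)
    · exact (ih₁ _ _).trans (by lia)
  | goto _ => simp [TM2.stepAux, pushes]
  | halt => simp [TM2.stepAux, pushes]

lemma Steps.length_le {C : ℕ} (hC : ∀ l, pushes (m l) ≤ C) {t : ℕ} {c d : TM2.Cfg Γ Λ σ}
    (h : Steps m t c d) (k : K) : (d.stk k).length ≤ (c.stk k).length + C * t := by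
  induction h with
  | refl => simp
  | @head t l v S d _ ih =>
    have hstep := (length_stepAux_le (m l) v S k).trans (Nat.add_le_add_left (hC l) _)
    rw [Nat.mul_succ]
    lia

end Steps

/-! ### Program fragments -/

/-- A stack program with finitely many labels and an entry label, which ends by halting. It is the
building block from which machines are composed. -/
structure Frag {K : Type} (Γ : K → Type) (σ : Type) where
  Λ : Type
  fin : Fintype Λ
  entry : Λ
  code : Λ → TM2.Stmt Γ Λ σ

/-- The stacks of which only the stack `k` is possibly nonempty, with contents `s`. -/
abbrev onlyStack {K : Type} [DecidableEq K] {Γ : K → Type} (k : K) (s : List (Γ k)) :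
    ∀ k, List (Γ k) :=
  Function.update (fun _ => []) k s

namespace Frag

variable {K : Type} [DecidableEq K] {Γ : K → Type} {σ : Type}

/-- The fragment turns the variable `v` and the stacks `S` into `v'` and `S'` in time `T`. -/
def Runs (F : Frag Γ σ) (v : σ) (S : ∀ k, List (Γ k)) (v' : σ) (S' : ∀ k, List (Γ k))
    (T : ℕ) : Prop :=
  ∃ t ≤ T, Steps F.code t ⟨some F.entry, v, S⟩ ⟨none, v', S'⟩

lemma Runs.mono {F : Frag Γ σ} {v v' : σ} {S S' : ∀ k, List (Γ k)} {T T' : ℕ}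
    (h : F.Runs v S v' S' T) (hT : T ≤ T') : F.Runs v S v' S' T' :=
  h.imp fun _ ⟨ht, hs⟩ => ⟨ht.trans hT, hs⟩

lemma exists_length_le (F : Frag Γ σ) : ∃ C, ∀ {v v' : σ} {S S' : ∀ k, List (Γ k)} {T : ℕ},
    F.Runs v S v' S' T → ∀ k, (S' k).length ≤ (S k).length + C * T := by
  have := F.fin
  refine ⟨∑ l, pushes (F.code l), fun ⟨t, ht, hs⟩ k => ?_⟩
  have hsum : ∀ l, pushes (F.code l) ≤ ∑ l, pushes (F.code l) := fun l =>
    Finset.single_le_sum (f := fun l => pushes (F.code l)) (fun _ _ => Nat.zero_le _)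
      (Finset.mem_univ l)
  exact (hs.length_le hsum k).trans (by gcongr)

/-- A fragment of one statement. -/
def single (q : TM2.Stmt Γ Unit σ) : Frag Γ σ := ⟨Unit, inferInstance, (), fun _ => q⟩

/-- Sequential composition. -/
def seq (F G : Frag Γ σ) : Frag Γ σ where
  Λ := F.Λ ⊕ G.Λ
  fin := by
    have := F.fin
    have := G.fin
    exact inferInstance
  entry := Sum.inl F.entry
  code := Sum.elim (fun l => relabel Sum.inl (some (Sum.inr G.entry)) (F.code l))
    fun l => relabel Sum.inr none (G.code l)

lemma Runs.seq {F G : Frag Γ σ} {v₁ v₂ v₃ : σ} {S₁ S₂ S₃ : ∀ k, List (Γ k)} {T₁ T₂ : ℕ}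
    (hF : F.Runs v₁ S₁ v₂ S₂ T₁) (hG : G.Runs v₂ S₂ v₃ S₃ T₂) :
    (F.seq G).Runs v₁ S₁ v₃ S₃ (T₁ + T₂) := by
  obtain ⟨t₁, ht₁, hF⟩ := hF
  obtain ⟨t₂, ht₂, hG⟩ := hG
  refine ⟨t₁ + t₂, Nat.add_le_add ht₁ ht₂, ?_⟩
  have runF := hF.simulate (m' := (F.seq G).code)
    (fun c => ⟨c.l.elim (some (Sum.inr G.entry)) fun l => some (Sum.inl l), c.var, c.stk⟩)
    fun l v S => .single (stepAux_relabel _ _ _ _ _)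
  have runG := hG.simulate (m' := (F.seq G).code)
    (fun c => ⟨c.l.elim none fun l => some (Sum.inr l), c.var, c.stk⟩)
    fun l v S => .single (stepAux_relabel _ _ _ _ _)
  exact runF.trans runG

/-- Move the stack `k` to the stack `k'`, which reverses it: `read` stores a removed symbol in the
variable, `more` tells whether there was one, and `write` turns it into a symbol of `k'`. -/
def transfer (k k' : K) (read : σ → Option (Γ k) → σ) (more : σ → Bool) (write : σ → Γ k') :
    Frag Γ σ :=
  single (.pop k read (.branch more (.push k' write (.goto fun _ => ())) .halt))

lemma transfer_runs {k k' : K} (hk : k ≠ k') {read : σ → Option (Γ k) → σ} {more : σ → Bool}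
    {write : σ → Γ k'} {f : Γ k → Γ k'} (hread : ∀ v o o', read (read v o) o' = read v o')
    (hmore : ∀ v o, more (read v o) = o.isSome) (hwrite : ∀ v a, write (read v (some a)) = f a)
    (v : σ) {S : ∀ k, List (Γ k)} {s : List (Γ k)} (hs : S k = s) :
    (transfer k k' read more write).Runs v S (read v none)
      (Function.update (Function.update S k []) k' ((s.map f).reverse ++ S k'))
      (s.length + 1) := by
  induction s generalizing v S with
  | nil =>
    have hS : Function.update (Function.update S k []) k' (S k') = Function.update S k [] :=
      Function.update_eq_self_iff.2 (Function.update_of_ne hk.symm _ _).symm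
    exact ⟨1, by simp, .single (by simp [transfer, single, TM2.stepAux, hs, hmore, hS])⟩
  | cons a s ih =>
    obtain ⟨t, ht, h⟩ := ih (read v (some a))
      (S := Function.update (Function.update S k s) k' (f a :: S k')) (by simp [hk])
    refine ⟨t + 1, by simpa using ht, .head ?_⟩
    rw [hread, Function.update_comm hk.symm, Function.update_idem, Function.update_idem,
      Function.update_self] at h
    simpa [transfer, single, TM2.stepAux, hs, hmore, hwrite, hk.symm] using h

/-- The fragment as a machine with input stack `k₀`, output stack `k₁` and initial variable `v₀`. -/
def toFinTM2 [Fintype K] [Fintype σ] (F : Frag Γ σ) (k₀ k₁ : K) [Fintype (Γ k₀)] (v₀ : σ) :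
    FinTM2 where
  K := K
  k₀ := k₀
  k₁ := k₁
  Γ := Γ
  Λ := F.Λ
  main := F.entry
  ΛFin := F.fin
  σ := σ
  initialState := v₀
  m := F.code

/-- The program of a machine. -/
def ofFinTM2 (tm : FinTM2) : Frag tm.Γ tm.σ := ⟨tm.Λ, tm.ΛFin, tm.main, tm.m⟩

lemma initList_eq (tm : FinTM2) (s : List (tm.Γ tm.k₀)) :
    initList tm s = ⟨some tm.main, tm.initialState, onlyStack tm.k₀ s⟩ := by
  refine congrArg (TM2.Cfg.mk _ _) (funext fun k => ?_)
  by_cases h : k = tm.k₀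
  · subst h; simp
  · simp [h]

lemma haltList_eq (tm : FinTM2) (s : List (tm.Γ tm.k₁)) :
    haltList tm s = ⟨none, tm.initialState, onlyStack tm.k₁ s⟩ := by
  refine congrArg (TM2.Cfg.mk _ _) (funext fun k => ?_)
  by_cases h : k = tm.k₁
  · subst h; simp
  · simp [h]

lemma outputsInTime_iff_runs {tm : FinTM2} {s : List (tm.Γ tm.k₀)} {s' : List (tm.Γ tm.k₁)}
    {T : ℕ} : Nonempty (TM2OutputsInTime tm s (some s') T) ↔
      (ofFinTM2 tm).Runs tm.initialState (onlyStack tm.k₀ s) tm.initialState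
        (onlyStack tm.k₁ s') T := by
  have hsteps (t : ℕ) : (flip Bind.bind tm.step)^[t] (some (initList tm s)) =
      some (haltList tm s') ↔ Steps tm.m t ⟨some tm.main, tm.initialState, onlyStack tm.k₀ s⟩
        ⟨none, tm.initialState, onlyStack tm.k₁ s'⟩ := by
    rw [initList_eq, haltList_eq]
    exact iterate_step_eq_some_iff
  exact ⟨fun ⟨h⟩ => ⟨h.steps, h.steps_le_m, (hsteps _).1 h.evals_in_steps⟩,
    fun ⟨t, ht, h⟩ => ⟨⟨⟨t, (hsteps t).2 h⟩, ht⟩⟩⟩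

theorem polyTime [Finite K] [Finite σ] {k₀ k₁ : K} [Finite (Γ k₀)] (F : Frag Γ σ) (v₀ : σ)
    {α β : Type} {ea : α → List (Γ k₀)} {eb : β → List (Γ k₁)} {f : α → β} {T : α → ℕ}
    (hT : PolyBounded (fun a => (ea a).length) T)
    (hF : ∀ a, F.Runs v₀ (onlyStack k₀ (ea a)) v₀ (onlyStack k₁ (eb (f a))) (T a)) :
    Nonempty (TM2ComputableInPolyTime ea eb f) := by
  obtain ⟨P, hP⟩ := hT
  have := Fintype.ofFinite K
  have := Fintype.ofFinite σ
  have := Fintype.ofFinite (Γ k₀)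
  refine ⟨⟨⟨F.toFinTM2 k₀ k₁ v₀, Equiv.refl _, Equiv.refl _⟩, P, fun a =>
    (outputsInTime_iff_runs.2 ?_).some⟩⟩
  have h := hF a
  rw [← List.map_id (ea a), ← List.map_id (eb (f a))] at h
  exact h.mono (hP a)

end Frag

/-! ### Programs for stacks of bits -/

/-- Programs whose stacks, indexed by `R`, consist of bits, with one variable, which holds the
result of the last removal of a bit from a stack. -/
abbrev Prog (R : Type) : Type 1 := Frag (fun _ : R => Bool) (Option Bool)

namespace Prog

variable {R : Type} [DecidableEq R] {F G : Prog R} {S S₁ S₂ S₃ S' : R → List Bool} {T T₁ T₂ : ℕ}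

/-- The program turns the stacks `S` into `S'` in time `T`, whatever the value of the variable. -/
def Does (F : Prog R) (S S' : R → List Bool) (T : ℕ) : Prop :=
  ∀ v, ∃ v', Frag.Runs F v S v' S' T

lemma Does.of_eq_of_le (h : Does F S S₁ T₁) (hS : S₁ = S') (hT : T₁ ≤ T) : Does F S S' T :=
  fun v => (h v).imp fun _ h => (hS ▸ h).mono hT

lemma Does.mono (h : Does F S S' T₁) (hT : T₁ ≤ T) : Does F S S' T := h.of_eq_of_le rfl hT

lemma Does.seq (hF : Does F S₁ S₂ T₁) (hG : Does G S₂ S₃ T₂) :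
    Does (Frag.seq F G) S₁ S₃ (T₁ + T₂) := by
  intro v
  obtain ⟨v₂, hF⟩ := hF v
  obtain ⟨v₃, hG⟩ := hG v₂
  exact ⟨v₃, hF.seq hG⟩

/-- The program that does nothing. -/
def skip : Prog R := Frag.single .halt

lemma skip_does (S : R → List Bool) : Does skip S S 1 :=
  fun v => ⟨v, 1, le_rfl, .single rfl⟩

/-- Put a bit on a stack. -/
def push (k : R) (b : Bool) : Prog R := Frag.single (.push k (fun _ => b) .halt)

lemma push_does (k : R) (b : Bool) (S : R → List Bool) :
    Does (push k b) S (Function.update S k (b :: S k)) 1 :=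
  fun v => ⟨v, 1, le_rfl, .single rfl⟩

/-- Put a string on a stack, so that its first symbol is on top. -/
def emit (k : R) (w : List Bool) : Prog R :=
  w.foldr (fun b F => Frag.seq F (push k b)) skip

lemma emit_does (k : R) (w : List Bool) (S : R → List Bool) :
    Does (emit k w) S (Function.update S k (w ++ S k)) (w.length + 1) := by
  induction w with
  | nil => simpa [emit] using skip_does S
  | cons b w ih =>
    have h := ih.seq (push_does k b _)
    simp only [Function.update_self, Function.update_idem] at h
    exact h.mono (by simp)

/-- Move the stack `a` to the stack `b`, whereby it is reversed. -/
def move (a b : R) : Prog R :=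
  Frag.transfer a b (fun _ o => o) Option.isSome fun o => o.getD false

lemma move_does {a b : R} (hab : a ≠ b) (S : R → List Bool) :
    Does (move a b) S (Function.update (Function.update S a []) b ((S a).reverse ++ S b))
      ((S a).length + 1) := by
  intro v
  have h := Frag.transfer_runs hab (read := fun _ o => o) (more := Option.isSome)
    (write := fun o : Option Bool => o.getD false) (f := id) (fun _ _ _ => rfl) (fun _ _ => rfl)
    (fun _ _ => rfl) v (S := S) rfl
  rw [List.map_id] at h
  exact ⟨none, h⟩

/-- Remove a bit from the stack `k`, run the program `F o` where `o` is this bit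
(`none` if the stack is empty), and repeat if `cont o` holds. -/
def popLoop (k : R) (cont : Option Bool → Bool) (F : Option Bool → Prog R) : Prog R where
  Λ := Option (Σ o, (F o).Λ)
  fin := by
    have := fun o => (F o).fin
    exact inferInstance
  entry := none
  code
    | none => .pop k (fun _ o => o) (.goto fun v => some ⟨v, (F v).entry⟩)
    | some ⟨o, l⟩ =>
      relabel (fun l => some ⟨o, l⟩) (if cont o then some none else none) ((F o).code l)

section PopLoop

variable {k : R} {cont : Option Bool → Bool} {F : Option Bool → Prog R}

lemma popLoop_steps (h : Does (F (S k).head?) (Function.update S k (S k).tail) S' T)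
    (v : Option Bool) : ∃ v', ∃ t ≤ T + 1, Steps (popLoop k cont F).code t ⟨some none, v, S⟩
      ⟨if cont (S k).head? then some none else none, v', S'⟩ := by
  obtain ⟨v', t, ht, h⟩ := h (S k).head?
  refine ⟨v', t + 1, by lia, .head ?_⟩
  exact h.simulate (m' := (popLoop k cont F).code)
    (fun c => ⟨c.l.elim (if cont (S k).head? then some none else none)
      fun l => some (some ⟨(S k).head?, l⟩), c.var, c.stk⟩)
    fun l v S => .single (stepAux_relabel _ _ _ _ _)

lemma popLoop_exit (o : Option Bool) (ho : (S k).head? = o) (hc : cont o = false)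
    (h : Does (F o) (Function.update S k (S k).tail) S' T) :
    Does (popLoop k cont F) S S' (T + 1) := by
  subst ho
  intro v
  obtain ⟨v', t, ht, h⟩ := popLoop_steps (cont := cont) h v
  rw [hc] at h
  exact ⟨v', t, ht, h⟩

lemma popLoop_next (o : Option Bool) (ho : (S k).head? = o) (hc : cont o = true)
    (h₁ : Does (F o) (Function.update S k (S k).tail) S₁ T₁)
    (h₂ : Does (popLoop k cont F) S₁ S' T₂) : Does (popLoop k cont F) S S' (T₁ + 1 + T₂) := by
  subst ho
  intro v
  obtain ⟨v₁, t₁, ht₁, h₁⟩ := popLoop_steps (cont := cont) h₁ v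
  obtain ⟨v', t₂, ht₂, h₂⟩ := h₂ v₁
  rw [hc] at h₁
  exact ⟨v', t₁ + t₂, by lia, h₁.trans h₂⟩

end PopLoop

/-- Empty the stack `a`. -/
def clear (a : R) : Prog R := popLoop a Option.isSome fun _ => skip

lemma clear_does (a : R) (S : R → List Bool) :
    Does (clear a) S (Function.update S a []) (2 * (S a).length + 2) := by
  generalize hs : S a = s
  induction s generalizing S with
  | nil => exact popLoop_exit (T := 1) none (by simp [hs]) rfl (by simpa [hs] using skip_does _)
  | cons c s ih =>
    have h := ih (Function.update S a s) (by simp)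
    rw [Function.update_idem] at h
    exact (popLoop_next (T₁ := 1) (some c) (by simp [hs]) rfl
      (by simpa [hs] using skip_does _) h).mono (by simp; lia)

/-- Run `p` once for every bit on the stack `a`, which is kept; the stack `t` serves as temporary
memory. -/
def forEach (a t : R) (p : Prog R) : Prog R :=
  Frag.seq (popLoop a Option.isSome fun o => o.elim skip fun b => Frag.seq p (push t b)) (move t a)

/-- In time `T` and on stacks satisfying `I`, the program `p` puts `c` marks `true` on the stack
`k`. -/
def PutsMarks (p : Prog R) (I : (R → List Bool) → Prop) (k : R) (c T : ℕ) : Prop :=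
  ∀ S, I S → Does p S (Function.update S k (List.replicate c true ++ S k)) T

lemma push_putsMarks (k : R) : PutsMarks (push k true) (fun _ => True) k 1 1 :=
  fun S _ => push_does k true S

section ForEach

variable {p : Prog R} {I : (R → List Bool) → Prop} {a t k : R} {c : ℕ}

lemma PutsMarks.forEach_loop (hp : PutsMarks p I k c T) (hat : a ≠ t) (hak : a ≠ k) (htk : t ≠ k)
    (hI : ∀ S z, I S →
      I (Function.update S a z) ∧ I (Function.update S t z) ∧ I (Function.update S k z)) :
    ∀ (s : List Bool) (S), I S → S a = s →
      Does (popLoop a Option.isSome fun o => o.elim skip fun b => Frag.seq p (push t b)) S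
        (Function.update (Function.update (Function.update S a []) t (s.reverse ++ S t)) k
          (List.replicate (s.length * c) true ++ S k)) (s.length * (T + 2) + 2)
  | [], S, _, hs => by
    refine (popLoop_exit (T := 1) none (by simp [hs]) rfl (skip_does _)).of_eq_of_le ?_ (by simp)
    funext j
    rcases eq_or_ne j k with rfl | hk
    · simp [hak.symm]
    rcases eq_or_ne j t with rfl | ht
    · simp [hat.symm, hk]
    · simp [hs, hk, ht]
  | b :: s, S, hS, hs => by
    have body := (hp (Function.update S a s) (hI S s hS).1).seq (push_does t b _)
    rw [Function.update_of_ne hak.symm, Function.update_of_ne htk, Function.update_of_ne hat.symm]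
      at body
    have rest := forEach_loop hp hat hak htk hI s _
      (hI _ (b :: S t) (hI _ (List.replicate c true ++ S k) (hI S s hS).1).2.2).2.1
      (by simp [hat, hak])
    refine (popLoop_next (some b) (by simp [hs]) rfl (by simpa [hs] using body) rest).of_eq_of_le
      ?_ (by simp only [List.length_cons]; lia)
    funext j
    rcases eq_or_ne j k with rfl | hk
    · simp [htk.symm, ← List.append_assoc, Nat.succ_mul]
    rcases eq_or_ne j t with rfl | ht
    · simp [hk]
    rcases eq_or_ne j a with rfl | ha
    · simp [hk, ht]
    · simp [hk, ht, ha]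

lemma PutsMarks.forEach_does (hp : PutsMarks p I k c T) (hat : a ≠ t) (hak : a ≠ k) (htk : t ≠ k)
    (hI : ∀ S z, I S →
      I (Function.update S a z) ∧ I (Function.update S t z) ∧ I (Function.update S k z))
    (hS : I S) (ht : S t = []) :
    Does (forEach a t p) S (Function.update S k (List.replicate ((S a).length * c) true ++ S k))
      ((S a).length * (T + 3) + 3) := by
  have back := move_does hat.symm (Function.update (Function.update (Function.update S a []) t
    ((S a).reverse ++ S t)) k (List.replicate ((S a).length * c) true ++ S k))
  refine ((hp.forEach_loop hat hak htk hI (S a) S hS rfl).seq back).of_eq_of_le ?_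
    (by simp [htk, ht]; lia)
  funext j
  rcases eq_or_ne j a with rfl | ha
  · simp [hat, hak, ht, htk]
  rcases eq_or_ne j k with rfl | hk
  · simp [ha, htk.symm]
  rcases eq_or_ne j t with rfl | ht'
  · simp [ha, ht, hk]
  · simp [hk, ht', ha]

end ForEach

/-- Put one mark `true` on the stack `k` for every bit on the stack `a`, which is kept. -/
def copy (a k t : R) : Prog R := forEach a t (push k true)

lemma copy_putsMarks {a k t : R} (hat : a ≠ t) (hak : a ≠ k) (htk : t ≠ k) (n : ℕ) :
    PutsMarks (copy a k t) (fun S => (S a).length = n ∧ S t = []) k n (n * 4 + 3) := by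
  rintro S ⟨rfl, ht⟩
  simpa [copy] using (push_putsMarks k).forEach_does hat hak htk (fun _ _ h => ⟨h, h, h⟩) trivial ht

/-! ### Programs that run in polynomial time -/

section DoesPoly

variable {ι : Type*} {size : ι → ℕ} {S S' S₁ S₂ S₃ : ι → R → List Bool}

/-- For every `i`, the program turns the stacks `S i` into `S' i`, in a time that is polynomial in
`size i` if the lengths of the stacks `S i` are. Since these lengths bound those of the stacks
`S' i`, such programs can be composed without further assumptions. -/
def DoesPoly (size : ι → ℕ) (F : Prog R) (S S' : ι → R → List Bool) : Prop :=
  (∀ k, PolyBounded size fun i => (S i k).length) →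
    ∃ T, PolyBounded size T ∧ ∀ i, Does F (S i) (S' i) (T i)

lemma DoesPoly.of_does {T : ι → ℕ}
    (hT : (∀ k, PolyBounded size fun i => (S i k).length) → PolyBounded size T)
    (h : ∀ i, Does F (S i) (S' i) (T i)) : DoesPoly size F S S' :=
  fun hS => ⟨T, hT hS, h⟩

lemma DoesPoly.polyBounded_length (h : DoesPoly size F S S')
    (hS : ∀ k, PolyBounded size fun i => (S i k).length) (k : R) :
    PolyBounded size fun i => (S' i k).length := by
  obtain ⟨T, hT, h⟩ := h hS
  obtain ⟨C, hC⟩ := Frag.exists_length_le F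
  refine ((hS k).add ((PolyBounded.const C).mul hT)).mono fun i => ?_
  obtain ⟨_, h⟩ := h i none
  exact hC h k

lemma DoesPoly.seq (hF : DoesPoly size F S₁ S₂) (hG : DoesPoly size G S₂ S₃) :
    DoesPoly size (Frag.seq F G) S₁ S₃ := fun hS => by
  obtain ⟨T₁, hT₁, h₁⟩ := hF hS
  obtain ⟨T₂, hT₂, h₂⟩ := hG (hF.polyBounded_length hS)
  exact ⟨fun i => T₁ i + T₂ i, hT₁.add hT₂, fun i => (h₁ i).seq (h₂ i)⟩

lemma move_doesPoly {a b : R} (hab : a ≠ b) : DoesPoly size (move a b) S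
    fun i => Function.update (Function.update (S i) a []) b ((S i a).reverse ++ S i b) :=
  .of_does (fun hS => (hS a).add (.const 1)) fun i => move_does hab (S i)

lemma clear_doesPoly (a : R) : DoesPoly size (clear a) S fun i => Function.update (S i) a [] :=
  .of_does (fun hS => ((PolyBounded.const 2).mul (hS a)).add (.const 2)) fun i => clear_does a (S i)

end DoesPoly

end Prog

/-! ### Combining a machine with programs for stacks of bits -/

section Lift

variable {K K' : Type} [DecidableEq K] [DecidableEq K'] {Γ : K' → Type} {Λ σ σ' : Type}

/-- A statement for the stacks `e k` and a part of the variable as a statement for all stacks and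
the whole variable. The part of the variable is read by `get` and replaced by `set`. -/
def liftStmt (e : K → K') (get : σ' → σ) (set : σ' → σ → σ') :
    TM2.Stmt (fun k => Γ (e k)) Λ σ → TM2.Stmt Γ Λ σ'
  | .push k a q => .push (e k) (fun v => a (get v)) (liftStmt e get set q)
  | .peek k a q => .peek (e k) (fun v o => set v (a (get v) o)) (liftStmt e get set q)
  | .pop k a q => .pop (e k) (fun v o => set v (a (get v) o)) (liftStmt e get set q)
  | .load a q => .load (fun v => set v (a (get v))) (liftStmt e get set q)
  | .branch p q₁ q₂ =>
    .branch (fun v => p (get v)) (liftStmt e get set q₁) (liftStmt e get set q₂)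
  | .goto g => .goto fun v => g (get v)
  | .halt => .halt

variable {e : K → K'} {get : σ' → σ} {set : σ' → σ → σ'} {Ψ : σ → σ'}
  {Φ : (∀ k, List (Γ (e k))) → ∀ k', List (Γ k')}

lemma stepAux_liftStmt (hget : ∀ v, get (Ψ v) = v) (hset : ∀ v w, set (Ψ v) w = Ψ w)
    (hΦ : ∀ A k, Φ A (e k) = A k)
    (hΦ' : ∀ A k s, Function.update (Φ A) (e k) s = Φ (Function.update A k s))
    (q : TM2.Stmt (fun k => Γ (e k)) Λ σ) (v : σ) (A : ∀ k, List (Γ (e k))) :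
    TM2.stepAux (liftStmt e get set q) (Ψ v) (Φ A) =
      ⟨(TM2.stepAux q v A).l, Ψ (TM2.stepAux q v A).var, Φ (TM2.stepAux q v A).stk⟩ := by
  induction q generalizing v A with
  | push _ _ _ ih => simp only [liftStmt, TM2.stepAux, hget, hΦ, hΦ', ih]
  | peek _ _ _ ih => simp only [liftStmt, TM2.stepAux, hget, hset, hΦ, ih]
  | pop _ _ _ ih => simp only [liftStmt, TM2.stepAux, hget, hset, hΦ, hΦ', ih]
  | load _ _ ih => simp only [liftStmt, TM2.stepAux, hget, hset, ih]
  | branch p _ _ ih₁ ih₂ =>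
    simp only [liftStmt, TM2.stepAux, hget]
    cases p v
    · exact ih₂ _ _
    · exact ih₁ _ _
  | goto _ => simp only [liftStmt, TM2.stepAux, hget]
  | halt => rfl

/-- A fragment for the stacks `e k` and a part of the variable as a fragment for all stacks and
the whole variable. -/
def Frag.lift (e : K → K') (get : σ' → σ) (set : σ' → σ → σ') (F : Frag (fun k => Γ (e k)) σ) :
    Frag Γ σ' :=
  ⟨F.Λ, F.fin, F.entry, fun l => liftStmt e get set (F.code l)⟩

lemma Frag.Runs.lift (hget : ∀ v, get (Ψ v) = v) (hset : ∀ v w, set (Ψ v) w = Ψ w)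
    (hΦ : ∀ A k, Φ A (e k) = A k)
    (hΦ' : ∀ A k s, Function.update (Φ A) (e k) s = Φ (Function.update A k s))
    {F : Frag (fun k => Γ (e k)) σ} {v v' : σ} {A A' : ∀ k, List (Γ (e k))} {T : ℕ}
    (h : F.Runs v A v' A' T) : (F.lift e get set).Runs (Ψ v) (Φ A) (Ψ v') (Φ A') T := by
  obtain ⟨t, ht, h⟩ := h
  exact ⟨t, ht, h.simulate (fun c => ⟨c.l, Ψ c.var, Φ c.stk⟩)
    fun _ _ _ => .single (stepAux_liftStmt hget hset hΦ hΦ' _ _ _)⟩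

end Lift

section SumStacks

variable {K R : Type} [DecidableEq K] [DecidableEq R] {Γ : K → Type} {σ : Type}

/-- The alphabets of the stacks of a machine and of additional stacks of bits. -/
abbrev SumΓ (Γ : K → Type) (R : Type) : K ⊕ R → Type
  | .inl k => Γ k
  | .inr _ => Bool

/-- The stacks of a machine together with additional stacks of bits. -/
def joinStk (A : ∀ k, List (Γ k)) (B : R → List Bool) : ∀ k, List (SumΓ Γ R k)
  | .inl k => A k
  | .inr k => B k

lemma update_joinStk_inl (A : ∀ k, List (Γ k)) (B : R → List Bool) (k : K) (s : List (Γ k)) :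
    Function.update (joinStk A B) (.inl k) s = joinStk (Function.update A k s) B := by
  have h (A : ∀ k, List (Γ k)) :
      joinStk A B = Sum.rec (motive := fun k => List (SumΓ Γ R k)) A B := by
    funext j; cases j <;> rfl
  rw [h, h]
  exact (Sum.rec_update_left (γ := fun k => List (SumΓ Γ R k)) A B k s).symm

lemma update_joinStk_inr (A : ∀ k, List (Γ k)) (B : R → List Bool) (k : R) (s : List Bool) :
    Function.update (joinStk A B) (.inr k) s = joinStk A (Function.update B k s) := by
  have h (B : R → List Bool) :
      joinStk A B = Sum.rec (motive := fun k => List (SumΓ Γ R k)) A B := by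
    funext j; cases j <;> rfl
  rw [h, h]
  exact (Sum.rec_update_right (γ := fun k => List (SumΓ Γ R k)) A B k s).symm

lemma onlyStack_inr (k : R) (s : List Bool) :
    (onlyStack (.inr k) s : ∀ k, List (SumΓ Γ R k)) = joinStk (fun _ => []) (onlyStack k s) := by
  have h : (fun _ => []) = joinStk (fun _ => [] : ∀ k, List (Γ k)) fun _ : R => [] := by
    funext j; cases j <;> rfl
  rw [onlyStack, h, update_joinStk_inr]

/-- A fragment of a program of a machine, in the presence of additional stacks of bits. -/
def Frag.inl (R : Type) (F : Frag Γ σ) : Frag (SumΓ Γ R) (σ × Option Bool) :=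
  F.lift (Γ := SumΓ Γ R) Sum.inl Prod.fst fun v w => (w, v.2)

lemma Frag.Runs.inl {F : Frag Γ σ} {v v' : σ} {A A' : ∀ k, List (Γ k)} {T : ℕ}
    (h : F.Runs v A v' A' T) (w : Option Bool) (B : R → List Bool) :
    (F.inl R).Runs (v, w) (joinStk A B) (v', w) (joinStk A' B) T :=
  Frag.Runs.lift (Γ := SumΓ Γ R) (e := Sum.inl) (Ψ := fun v => (v, w))
    (Φ := fun A => joinStk A B) (fun _ => rfl) (fun _ _ => rfl) (fun _ _ => rfl)
    (fun _ _ _ => update_joinStk_inl _ _ _ _) h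

/-- A program for stacks of bits, in the presence of the stacks of a machine. -/
def Prog.inr (Γ : K → Type) (σ : Type) (F : Prog R) : Frag (SumΓ Γ R) (σ × Option Bool) :=
  F.lift (Γ := SumΓ Γ R) Sum.inr Prod.snd fun v w => (v.1, w)

lemma Prog.Does.inr {F : Prog R} {B B' : R → List Bool} {T : ℕ} (h : F.Does B B' T)
    (A : ∀ k, List (Γ k)) (v : σ) (w : Option Bool) :
    ∃ w', (F.inr Γ σ).Runs (v, w) (joinStk A B) (v, w') (joinStk A B') T := by
  obtain ⟨w', h⟩ := h w
  exact ⟨w', Frag.Runs.lift (Γ := SumΓ Γ R) (e := Sum.inr) (Ψ := fun w => (v, w))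
    (Φ := fun B => joinStk A B) (fun _ => rfl) (fun _ _ => rfl) (fun _ _ => rfl)
    (fun _ _ _ => update_joinStk_inr _ _ _ _) h⟩

/-- Move the stack `a` of bits to the stack `k`, whereby it is reversed and its bits are
translated by `f`. -/
def load (a : R) (k : K) (f : Bool → Γ k) : Frag (SumΓ Γ R) (σ × Option Bool) :=
  Frag.transfer (.inr a) (.inl k) (fun v o => (v.1, o)) (fun v => v.2.isSome)
    fun v => f (v.2.getD false)

lemma load_runs (a : R) (k : K) (f : Bool → Γ k) (v : σ) (w : Option Bool) (A : ∀ k, List (Γ k))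
    (B : R → List Bool) : (load a k f).Runs (v, w) (joinStk A B) (v, none)
      (joinStk (Function.update A k (((B a).map f).reverse ++ A k)) (Function.update B a []))
      ((B a).length + 1) := by
  have h := Frag.transfer_runs (Γ := SumΓ Γ R) (k := .inr a) (k' := .inl k) (by simp)
    (read := fun v o => (v.1, o)) (more := fun v : σ × Option Bool => v.2.isSome)
    (write := fun v => f (v.2.getD false)) (fun _ _ _ => rfl) (fun _ _ => rfl) (fun _ _ => rfl)
    (v, w) (S := joinStk A B) rfl
  rwa [update_joinStk_inr, update_joinStk_inl] at h

/-- Move the stack `k` to the stack `a` of bits, whereby it is reversed and its symbols are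
translated by `f`. -/
def unload (k : K) (a : R) (f : Γ k → Bool) : Frag (SumΓ Γ R) (σ × Option Bool) :=
  Frag.transfer (.inl k) (.inr a) (fun v o => (v.1, o.map f)) (fun v => v.2.isSome)
    fun v => v.2.getD false

lemma unload_runs (k : K) (a : R) (f : Γ k → Bool) (v : σ) (w : Option Bool)
    (A : ∀ k, List (Γ k)) (B : R → List Bool) :
    (unload k a f).Runs (v, w) (joinStk A B) (v, none)
      (joinStk (Function.update A k []) (Function.update B a (((A k).map f).reverse ++ B a)))
      ((A k).length + 1) := by
  have h := Frag.transfer_runs (Γ := SumΓ Γ R) (k := .inl k) (k' := .inr a) (by simp)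
    (read := fun v o => (v.1, o.map f)) (more := fun v : σ × Option Bool => v.2.isSome)
    (write := fun v => v.2.getD false) (f := f) (fun _ _ _ => rfl) (by simp) (fun _ _ => rfl)
    (v, w) (S := joinStk A B) rfl
  rwa [update_joinStk_inl, update_joinStk_inr] at h

end SumStacks

section Wrap

variable {α β γ : Type} {ea : α → List Bool} {eb : β → List Bool} {f : α → β}

lemma polyTime_runs (h : TM2ComputableInPolyTime ea eb f) (a : α) :
    (Frag.ofFinTM2 h.tm).Runs h.tm.initialState
      (onlyStack h.tm.k₀ ((ea a).map h.inputAlphabet.symm)) h.tm.initialState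
      (onlyStack h.tm.k₁ ((eb (f a)).map h.outputAlphabet.symm)) (h.time.eval (ea a).length) :=
  Frag.outputsInTime_iff_runs.1 ⟨h.outputsFun a⟩

lemma polyBounded_time (h : TM2ComputableInPolyTime ea eb f) :
    PolyBounded (fun a => (ea a).length) fun a => h.time.eval (ea a).length :=
  ⟨h.time, fun _ => le_rfl⟩

lemma polyBounded_length_output (h : TM2ComputableInPolyTime ea eb f) :
    PolyBounded (fun a => (ea a).length) fun a => (eb (f a)).length := by
  obtain ⟨C, hC⟩ := Frag.exists_length_le (Frag.ofFinTM2 h.tm)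
  refine (PolyBounded.self.add ((PolyBounded.const C).mul (polyBounded_time h))).mono fun a => ?_
  have hlen := hC (polyTime_runs h a) h.tm.k₁
  rw [onlyStack, Function.update_self, List.length_map] at hlen
  refine hlen.trans (Nat.add_le_add_right ?_ _)
  by_cases hk : h.tm.k₁ = h.tm.k₀
  · rw [hk]; simp
  · simp [hk]

variable {R : Type} [DecidableEq R]

/-- Run a machine on the reverse of the stack `aux`, and put the reverse of its output there. -/
def call (h : TM2ComputableInPolyTime ea eb f) (aux : R) :
    Frag (SumΓ h.tm.Γ R) (h.tm.σ × Option Bool) :=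
  (load aux h.tm.k₀ h.inputAlphabet.symm).seq
    (((Frag.ofFinTM2 h.tm).inl R).seq (unload h.tm.k₁ aux h.outputAlphabet))

lemma call_runs (h : TM2ComputableInPolyTime ea eb f) (aux : R) (a : α) (w : Option Bool)
    (B : R → List Bool) : (call h aux).Runs
      (h.tm.initialState, w) (joinStk (fun _ => []) (Function.update B aux (ea a).reverse))
      (h.tm.initialState, none)
      (joinStk (fun _ => []) (Function.update B aux (eb (f a)).reverse))
      ((ea a).length + 1 + (h.time.eval (ea a).length + ((eb (f a)).length + 1))) := by
  have input := load_runs aux h.tm.k₀ h.inputAlphabet.symm h.tm.initialState w (fun _ => [])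
    (Function.update B aux (ea a).reverse)
  have run := (polyTime_runs h a).inl none (Function.update B aux [])
  have output := unload_runs h.tm.k₁ aux h.outputAlphabet h.tm.initialState none
    (onlyStack h.tm.k₁ ((eb (f a)).map h.outputAlphabet.symm)) (Function.update B aux [])
  simp only [Function.update_self, Function.update_idem, List.map_reverse, List.reverse_reverse,
    List.append_nil, List.length_reverse] at input
  simp only [Function.update_self, Function.update_idem, Function.update_eq_self, List.map_map,
    Equiv.self_comp_symm, List.map_id, List.append_nil, List.length_map] at output
  exact input.seq (run.seq output)

/-- Run a program, then a machine by means of `call`, then another program. -/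
def wrap (h : TM2ComputableInPolyTime ea eb f) (aux : R) (pre post : Prog R) :
    Frag (SumΓ h.tm.Γ R) (h.tm.σ × Option Bool) :=
  (pre.inr h.tm.Γ h.tm.σ).seq ((call h aux).seq
    ((post.inr h.tm.Γ h.tm.σ).seq (Frag.single (.load (fun v => (v.1, none)) .halt))))

lemma wrap_runs (h : TM2ComputableInPolyTime ea eb f) {aux : R} {pre post : Prog R} {a : α}
    {B B₀ B₁ : R → List Bool} {T₁ T₂ : ℕ}
    (hpre : pre.Does B₀ (Function.update B aux (ea a).reverse) T₁)
    (hpost : post.Does (Function.update B aux (eb (f a)).reverse) B₁ T₂) :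
    (wrap h aux pre post).Runs
      (h.tm.initialState, none) (joinStk (fun _ => []) B₀)
      (h.tm.initialState, none) (joinStk (fun _ => []) B₁)
      (T₁ + ((ea a).length + 1 + (h.time.eval (ea a).length + ((eb (f a)).length + 1)) +
        (T₂ + 1))) := by
  obtain ⟨w, hpre⟩ := hpre.inr (Γ := h.tm.Γ) (fun _ => []) h.tm.initialState none
  obtain ⟨_, hpost⟩ := hpost.inr (Γ := h.tm.Γ) (fun _ => []) h.tm.initialState none
  exact hpre.seq ((call_runs h aux a w B).seq (hpost.seq ⟨1, le_rfl, .single rfl⟩))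

theorem polyTime_of_wrap [Finite R] (h : TM2ComputableInPolyTime ea eb f) {ea' : α → List Bool}
    {eg : γ → List Bool} {g : α → γ} (inp aux out : R) (pre post : Prog R)
    (B : α → R → List Bool)
    (hpre : Prog.DoesPoly (fun a => (ea' a).length) pre (fun a => onlyStack inp (ea' a))
      fun a => Function.update (B a) aux (ea a).reverse)
    (hpost : Prog.DoesPoly (fun a => (ea' a).length) post
      (fun a => Function.update (B a) aux (eb (f a)).reverse) fun a => onlyStack out (eg (g a))) :
    Nonempty (TM2ComputableInPolyTime ea' eg g) := by
  have hinp (k : R) : PolyBounded (fun a => (ea' a).length)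
      fun a => (onlyStack (Γ := fun _ => Bool) inp (ea' a) k).length := by
    refine PolyBounded.self.mono fun a => ?_
    by_cases hk : k = inp
    · subst hk; simp
    · simp [hk]
  have hmid := hpre.polyBounded_length hinp
  have hea : PolyBounded (fun a => (ea' a).length) fun a => (ea a).length := by
    simpa using hmid aux
  have heb : PolyBounded (fun a => (ea' a).length) fun a => (eb (f a)).length :=
    (polyBounded_length_output h).trans hea
  obtain ⟨T₁, hT₁, hpre⟩ := hpre hinp
  obtain ⟨T₂, hT₂, hpost⟩ := hpost fun k => by
    by_cases hk : k = aux
    · subst hk; simpa using heb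
    · simpa [hk] using hmid k
  have := h.tm.kFin
  have := h.tm.σFin
  have htime := (polyBounded_time h).trans hea
  have hT := hT₁.add (((hea.add (.const 1)).add (htime.add (heb.add (.const 1)))).add
    (hT₂.add (.const 1)))
  refine Frag.polyTime (k₀ := Sum.inr inp) (k₁ := Sum.inr out) (wrap h aux pre post)
    (h.tm.initialState, none) hT fun a => ?_
  rw [onlyStack_inr, onlyStack_inr]
  exact wrap_runs h (hpre a) (hpost a)

end Wrap

/-! ### Unary powers -/

/-- The stacks of the program that translates circuits: the input, its copy or the (reversed) code
in progress, the unary number of qubits of the new circuit, the output, three unary numbers and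
temporary memory. -/
inductive Reg : Type
  | inp | aux | hdr | out | len | num | sq | prod | tmp | tmp'
  deriving DecidableEq

instance : Fintype Reg :=
  ⟨{.inp, .aux, .hdr, .out, .len, .num, .sq, .prod, .tmp, .tmp'}, fun k => by cases k <;> decide⟩

/-- The contents of the stacks between two steps of the translation, where temporary memory is
empty and the stacks `len`, `num`, `sq` hold numbers in unary. -/
structure Regs where
  inp : List Bool := []
  aux : List Bool := []
  hdr : List Bool := []
  out : List Bool := []
  len : ℕ := 0
  num : ℕ := 0
  sq : ℕ := 0

namespace Regs

/-- The stacks with the given contents. -/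
def stk (r : Regs) : Reg → List Bool
  | .inp => r.inp
  | .aux => r.aux
  | .hdr => r.hdr
  | .out => r.out
  | .len => List.replicate r.len true
  | .num => List.replicate r.num true
  | .sq => List.replicate r.sq true
  | _ => []

variable (r : Regs) (s : List Bool) (n : ℕ)

lemma update_inp : Function.update r.stk .inp s = { r with inp := s }.stk := by
  funext k; cases k <;> rfl

lemma update_aux : Function.update r.stk .aux s = { r with aux := s }.stk := by
  funext k; cases k <;> rfl

lemma update_hdr : Function.update r.stk .hdr s = { r with hdr := s }.stk := by
  funext k; cases k <;> rfl

lemma update_out : Function.update r.stk .out s = { r with out := s }.stk := by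
  funext k; cases k <;> rfl

lemma update_len :
    Function.update r.stk .len (List.replicate n true) = { r with len := n }.stk := by
  funext k; cases k <;> rfl

lemma update_num :
    Function.update r.stk .num (List.replicate n true) = { r with num := n }.stk := by
  funext k; cases k <;> rfl

lemma update_sq :
    Function.update r.stk .sq (List.replicate n true) = { r with sq := n }.stk := by
  funext k; cases k <;> rfl

lemma onlyStack_inp : (onlyStack .inp s : Reg → List Bool) = Regs.stk { inp := s } := by
  funext k; cases k <;> rfl

lemma onlyStack_out : (onlyStack .out s : Reg → List Bool) = Regs.stk { out := s } := by
  funext k; cases k <;> rfl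

end Regs

namespace Prog

/-- Multiply the unary number on the stack `k` by the one on the stack `len`. -/
def mulLen (k : Reg) : Prog Reg :=
  (forEach .len .tmp (copy k .prod .tmp')).seq ((clear k).seq (move .prod k))

lemma mulLen_does {k : Reg} (hk : k ∉ [Reg.len, .prod, .tmp, .tmp']) {S : Reg → List Bool}
    {m n : ℕ} (hm : S k = List.replicate m true) (hn : (S .len).length = n) (hprod : S .prod = [])
    (htmp : S .tmp = []) (htmp' : S .tmp' = []) :
    Does (mulLen k) S (Function.update S k (List.replicate (m * n) true))
      (n * (m * 4 + 6) + 3 + (2 * m + 2 + (m * n + 1))) := by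
  simp only [List.mem_cons, List.not_mem_nil, or_false, not_or] at hk
  obtain ⟨hlen, hp, ht, ht'⟩ := hk
  have multiply := (copy_putsMarks (k := .prod) (t := .tmp') ht' hp (by simp) m).forEach_does
    (a := .len) (t := .tmp) (by simp) (by simp) (by simp)
    (fun S z h => by simpa [hlen, hp, ht] using h) (S := S) (by simp [hm, htmp']) htmp
  have erase := clear_does k
    (Function.update S .prod (List.replicate ((S .len).length * m) true ++ S .prod))
  have back := move_does (Ne.symm hp) (Function.update (Function.update S .prod
    (List.replicate ((S .len).length * m) true ++ S .prod)) k [])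
  refine (multiply.seq (erase.seq back)).of_eq_of_le ?_ ?_
  · funext j
    rcases eq_or_ne j k with rfl | hj
    · simp [hprod, Ne.symm hp, hn, Nat.mul_comm]
    rcases eq_or_ne j .prod with rfl | hj'
    · simp [hj, hprod]
    · simp [hj, hj']
  · simp [hn, hm, hp, Ne.symm hp, hprod, Nat.mul_comm]

lemma mulLen_doesPoly {ι : Type*} {size : ι → ℕ} {k : Reg}
    (hk : k ∉ [Reg.len, .prod, .tmp, .tmp']) (r : ι → Regs) (m : ι → ℕ) :
    DoesPoly size (mulLen k)
      (fun i => Function.update (r i).stk k (List.replicate (m i) true))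
      fun i => Function.update (r i).stk k (List.replicate (m i * (r i).len) true) := by
  have hne := hk
  simp only [List.mem_cons, List.not_mem_nil, or_false, not_or] at hne
  obtain ⟨hlen, hp, ht, ht'⟩ := hne
  refine .of_does (T := fun i => _) (fun hS => ?_) fun i => by
    simpa only [Function.update_idem] using
      mulLen_does hk (S := Function.update (r i).stk k (List.replicate (m i) true))
        (m := m i) (n := (r i).len) (by simp) (by simp [Ne.symm hlen, Regs.stk])
        (by simp [Ne.symm hp, Regs.stk]) (by simp [Ne.symm ht, Regs.stk])
        (by simp [Ne.symm ht', Regs.stk])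
  have hn : PolyBounded size fun i => (r i).len := by simpa [Ne.symm hlen, Regs.stk] using hS .len
  have hm : PolyBounded size m := by simpa using hS k
  exact ((hn.mul ((hm.mul (.const 4)).add (.const 6))).add (.const 3)).add
    ((((PolyBounded.const 2).mul hm).add (.const 2)).add ((hm.mul hn).add (.const 1)))

/-- Put on the stack `k` the `e`-th power of the unary number on the stack `len`. -/
def power (k : Reg) : ℕ → Prog Reg
  | 0 => push k true
  | e + 1 => (power k e).seq (mulLen k)

lemma power_doesPoly {ι : Type*} {size : ι → ℕ} {k : Reg}
    (hk : k ∉ [Reg.len, .prod, .tmp, .tmp']) (r : ι → Regs) (hr : ∀ i, (r i).stk k = []) (e : ℕ) :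
    DoesPoly size (power k e) (fun i => (r i).stk)
      fun i => Function.update (r i).stk k (List.replicate ((r i).len ^ e) true) := by
  induction e with
  | zero =>
    exact .of_does (fun _ => .const 1) fun i => by
      simpa [power, hr i] using push_does k true (r i).stk
  | succ e ih => exact ih.seq (mulLen_doesPoly hk r fun i => (r i).len ^ e)

section PopInp

variable {cont : Option Bool → Bool} {F : Option Bool → Prog Reg} {r : Regs} {b : Bool}
  {x : List Bool} {S S' : Reg → List Bool} {T T₁ T₂ : ℕ}

lemma popInp_exit (hr : r.inp = b :: x) (hc : cont (some b) = false)
    (hF : Does (F (some b)) { r with inp := x }.stk S' T) :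
    Does (popLoop .inp cont F) r.stk S' (T + 1) :=
  popLoop_exit (some b) (by simp [Regs.stk, hr]) hc (by simpa [Regs.update_inp, Regs.stk, hr])

lemma popInp_next (hr : r.inp = b :: x) (hc : cont (some b) = true)
    (hF : Does (F (some b)) { r with inp := x }.stk S T₁)
    (hloop : Does (popLoop .inp cont F) S S' T₂) :
    Does (popLoop .inp cont F) r.stk S' (T₁ + 1 + T₂) :=
  popLoop_next (some b) (by simp [Regs.stk, hr]) hc (by simpa [Regs.update_inp, Regs.stk, hr])
    hloop

end PopInp

lemma push_aux_does (b : Bool) (r : Regs) :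
    Does (push .aux b) r.stk { r with aux := b :: r.aux }.stk 1 := by
  simpa [Regs.update_aux, Regs.stk] using push_does Reg.aux b r.stk

lemma push_hdr_does (b : Bool) (r : Regs) :
    Does (push .hdr b) r.stk { r with hdr := b :: r.hdr }.stk 1 := by
  simpa [Regs.update_hdr, Regs.stk] using push_does Reg.hdr b r.stk

lemma push_out_does (b : Bool) (r : Regs) :
    Does (push .out b) r.stk { r with out := b :: r.out }.stk 1 := by
  simpa [Regs.update_out, Regs.stk] using push_does Reg.out b r.stk

lemma push_len_does (r : Regs) :
    Does (push .len true) r.stk { r with len := r.len + 1 }.stk 1 := by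
  simpa [← Regs.update_len, List.replicate_succ, Regs.stk] using push_does Reg.len true r.stk

/-- Move the input to the stack `aux`, and count its bits on the stack `len`. -/
def readInput : Prog Reg :=
  popLoop .inp Option.isSome fun o => o.elim skip fun b => (push .len true).seq (push .aux b)

lemma readInput_does (r : Regs) : Does readInput r.stk
    { r with inp := [], aux := r.inp.reverse ++ r.aux, len := r.inp.length + r.len }.stk
    (r.inp.length * 3 + 2) := by
  generalize hx : r.inp = x
  induction x generalizing r with
  | nil =>
    refine (popLoop_exit (T := 1) none (by simp [Regs.stk, hx]) rfl (skip_does _)).of_eq_of_le ?_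
      (by simp)
    simp [Regs.update_inp, Regs.stk, hx]
  | cons b x ih =>
    have body := (push_len_does { r with inp := x }).seq (push_aux_does b _)
    refine (popInp_next hx rfl body (ih _ rfl)).of_eq_of_le ?_ ?_
    · simp [Nat.add_right_comm, ← Nat.add_assoc]
    · simp only [List.length_cons]; lia

/-- Move the input to the stack `aux`, and compute `N = (n + 2) ^ j` and `N ^ 2` in unary, where
`n` is the length of the input. -/
def prepare (j : ℕ) : Prog Reg :=
  readInput.seq <| (push .len true).seq <| (push .len true).seq <| (power .num j).seq <|
    (power .sq (j * 2)).seq (clear .len)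

lemma prepare_doesPoly (j : ℕ) : DoesPoly List.length (prepare j) (fun x => onlyStack .inp x)
    fun x => Function.update
      (Regs.stk { num := (x.length + 2) ^ j, sq := ((x.length + 2) ^ j) ^ 2 }) .aux x.reverse := by
  have read : DoesPoly List.length readInput (fun x => onlyStack .inp x)
      fun x => Regs.stk { aux := x.reverse, len := x.length } :=
    .of_does (fun _ => (PolyBounded.self.mul (.const 3)).add (.const 2)) fun x => by
      simpa [Regs.onlyStack_inp] using readInput_does { inp := x }
  have one (r : List Bool → Regs) : DoesPoly List.length (push .len true) (fun x => (r x).stk)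
      fun x => { r x with len := (r x).len + 1 }.stk :=
    .of_does (fun _ => .const 1) fun x => push_len_does (r x)
  have num := power_doesPoly (size := List.length) (k := .num) (by decide)
    (fun x => { aux := x.reverse, len := x.length + 2 }) (fun _ => rfl) j
  have sq := power_doesPoly (size := List.length) (k := .sq) (by decide)
    (fun x => { aux := x.reverse, len := x.length + 2, num := (x.length + 2) ^ j }) (fun _ => rfl)
    (j * 2)
  simp only [Regs.update_num, Regs.update_sq, pow_mul] at num sq
  refine read.seq <| (one _).seq <| (one _).seq <| num.seq <| sq.seq <|
    .of_does (fun hS => ((PolyBounded.const 2).mul (hS Reg.len)).add (.const 2)) fun x => ?_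
  exact (clear_does Reg.len _).of_eq_of_le
    (by rw [Regs.update_aux]; exact Regs.update_len _ 0) le_rfl

end Prog

/-! ### Translation of the codes of circuits -/

/-- The position of qubit `i` of a circuit in the larger register, where position `1` is taken by
the control qubit. -/
def shiftWire (i : ℕ) : ℕ := if i = 0 then 0 else i + 1

/-- The code of the controlled gate, with the control qubit at position `1`, where `wH`, `wT`, `wC`
are the codes of the matrices of the controlled gates. -/
def StdGate.ctrlCode (wH wT wC : List Bool) {m : ℕ} : StdGate m → List Bool
  | .h i => codeNat 2 ++ codeNat 1 ++ codeNat (shiftWire i) ++ wH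
  | .t i => codeNat 2 ++ codeNat 1 ++ codeNat (shiftWire i) ++ wT
  | .cx a b _ => codeNat 3 ++ codeNat 1 ++ codeNat (shiftWire a) ++ codeNat (shiftWire b) ++ wC

lemma codeNat_succ (i : ℕ) : codeNat (i + 1) = true :: codeNat i := rfl

lemma length_codeNat (i : ℕ) : (codeNat i).length = i + 1 := by simp [codeNat]

/-- A symbol of a text in which the numbers `N` and `N ^ 2` occur in unary. -/
inductive Symbol : Type
  | bit (b : Bool)
  | num
  | sq

/-- The string denoted by a symbol. -/
def Symbol.val (N : ℕ) : Symbol → List Bool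
  | .bit b => [b]
  | .num => List.replicate N true
  | .sq => List.replicate (N ^ 2) true

namespace Prog

/-- Append a string to the reversed string on the stack `aux`. -/
def append (w : List Bool) : Prog Reg := emit .aux w.reverse

lemma append_does (w : List Bool) (r : Regs) :
    Does (append w) r.stk { r with aux := w.reverse ++ r.aux }.stk (w.length + 1) := by
  simpa [append, Regs.update_aux, Regs.stk] using emit_does Reg.aux w.reverse r.stk

/-- Copy the code of a number from the stack `inp` to the stack `aux`. -/
def copyNat : Prog Reg :=
  popLoop .inp (fun o => o == some true) fun o => push .aux (o == some true)

lemma copyNat_does {r : Regs} {i : ℕ} {x : List Bool} (hr : r.inp = codeNat i ++ x) :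
    Does copyNat r.stk { r with inp := x, aux := (codeNat i).reverse ++ r.aux }.stk
      (2 * i + 2) := by
  induction i generalizing r with
  | zero => exact popInp_exit hr rfl (push_aux_does false _)
  | succ i ih =>
    exact (popInp_next hr rfl (push_aux_does true _) (ih rfl)).of_eq_of_le
      (by simp [codeNat_succ]) (by lia)

/-- Copy the code of a number `i`, which is replaced by `shiftWire i`. -/
def copyShift : Prog Reg :=
  popLoop .inp (fun _ => false) fun
    | some true => (push .aux true).seq ((push .aux true).seq copyNat)
    | _ => push .aux false

lemma copyShift_does {r : Regs} {i : ℕ} {x : List Bool} (hr : r.inp = codeNat i ++ x) :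
    Does copyShift r.stk { r with inp := x, aux := (codeNat (shiftWire i)).reverse ++ r.aux }.stk
      (2 * i + 5) := by
  rcases i with _ | i
  · exact Does.mono (popInp_exit hr rfl (push_aux_does false _)) (by lia)
  · exact (popInp_exit hr rfl ((push_aux_does true _).seq
      ((push_aux_does true _).seq (copyNat_does rfl)))).of_eq_of_le
      (by simp [shiftWire, codeNat_succ]) (by lia)

/-- Translate the code of a gate on one qubit, after its type has been read. -/
def gate1 (w : List Bool) : Prog Reg :=
  (append (codeNat 2 ++ codeNat 1)).seq (copyShift.seq (append w))

lemma gate1_does (w : List Bool) {r : Regs} {i : ℕ} {x : List Bool}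
    (hr : r.inp = codeNat i ++ x) : Does (gate1 w) r.stk
      { r with
        inp := x
        aux := (codeNat 2 ++ codeNat 1 ++ codeNat (shiftWire i) ++ w).reverse ++ r.aux }.stk
      (2 * i + w.length + 12) := by
  have shift := copyShift_does (r := { r with aux := (codeNat 2 ++ codeNat 1).reverse ++ r.aux }) hr
  have run := (append_does _ r).seq (shift.seq (append_does w _))
  exact run.of_eq_of_le (by simp) (by simp [length_codeNat]; lia)

/-- Translate the code of a gate on two qubits, after its type has been read. -/
def gate2 (w : List Bool) : Prog Reg :=
  (append (codeNat 3 ++ codeNat 1)).seq (copyShift.seq (copyShift.seq (append w)))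

lemma gate2_does (w : List Bool) {r : Regs} {i j : ℕ} {x : List Bool}
    (hr : r.inp = codeNat i ++ (codeNat j ++ x)) : Does (gate2 w) r.stk
      { r with
        inp := x
        aux := (codeNat 3 ++ codeNat 1 ++ codeNat (shiftWire i) ++ codeNat (shiftWire j) ++
          w).reverse ++ r.aux }.stk
      (2 * i + 2 * j + w.length + 18) := by
  have shift := copyShift_does (r := { r with aux := (codeNat 3 ++ codeNat 1).reverse ++ r.aux }) hr
  have run := (append_does _ r).seq (shift.seq ((copyShift_does rfl).seq (append_does w _)))
  exact run.of_eq_of_le (by simp) (by simp [length_codeNat]; lia)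

/-- Copy the number of qubits to the stack `hdr`. -/
def header : Prog Reg :=
  popLoop .inp (fun o => o == some true) fun
    | some true => push .hdr true
    | _ => skip

lemma header_does {r : Regs} {m : ℕ} {x : List Bool} (hr : r.inp = codeNat m ++ x) :
    Does header r.stk { r with inp := x, hdr := List.replicate m true ++ r.hdr }.stk
      (2 * r.inp.length) := by
  induction m generalizing r with
  | zero => exact Does.mono (popInp_exit hr rfl (skip_does _)) (by simp [hr, codeNat])
  | succ m ih =>
    have hr' : r.inp = true :: (codeNat m ++ x) := hr
    exact (popInp_next hr' rfl (push_hdr_does true _) (ih rfl)).of_eq_of_le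
      (by simp [List.replicate_succ']) (by simp only [hr', List.length_cons]; lia)

variable (wH wT wC : List Bool)

/-- Translate the code of a gate. -/
def gate : Prog Reg :=
  popLoop .inp (fun _ => false) fun
    | some true => popLoop .inp (fun _ => false) fun
      | some true => popLoop .inp (fun _ => false) fun _ => gate2 wC
      | _ => gate1 wT
    | _ => gate1 wH

lemma gate_does {m : ℕ} (g : StdGate m) {r : Regs} {x : List Bool} (hr : r.inp = g.code ++ x) :
    Does (gate wH wT wC) r.stk
      { r with inp := x, aux := (g.ctrlCode wH wT wC).reverse ++ r.aux }.stk
      (wH.length + wT.length + wC.length + 30 + 2 * g.code.length) := by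
  cases g with
  | h i =>
    exact Does.mono (popInp_exit hr rfl (gate1_does wH rfl))
      (by simp [StdGate.code, length_codeNat]; lia)
  | t i =>
    exact Does.mono (popInp_exit hr rfl (popInp_exit rfl rfl (gate1_does wT rfl)))
      (by simp [StdGate.code, length_codeNat]; lia)
  | cx a b ne =>
    have hr' : r.inp = true :: true :: false :: (codeNat a ++ (codeNat b ++ x)) := by
      simpa [StdGate.code, codeNat_succ, codeNat] using hr
    exact Does.mono (popInp_exit hr' rfl (popInp_exit rfl rfl (popInp_exit rfl rfl
      (gate2_does wC rfl)))) (by simp [StdGate.code, length_codeNat]; lia)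

/-- Translate the codes of the gates up to the end of the circuit, and increase the number of
qubits by one for every gate. -/
def gates : Prog Reg :=
  popLoop .inp (fun o => o == some true) fun
    | some true => (push .hdr true).seq ((push .aux true).seq (gate wH wT wC))
    | _ => push .aux false

lemma gates_does {m : ℕ} (gs : List (StdGate m)) {r : Regs}
    (hr : r.inp = gs.flatMap (fun g => true :: g.code) ++ [false]) : Does (gates wH wT wC) r.stk
      { r with
        inp := []
        aux := (gs.flatMap (fun g : StdGate m => true :: g.ctrlCode wH wT wC) ++
          [false]).reverse ++ r.aux
        hdr := List.replicate gs.length true ++ r.hdr }.stk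
      ((wH.length + wT.length + wC.length + 35) * r.inp.length) := by
  induction gs generalizing r with
  | nil => exact Does.mono (popInp_exit hr rfl (push_aux_does false _)) (by simp [hr])
  | cons g gs ih =>
    replace hr : r.inp = true ::
      (g.code ++ (gs.flatMap (fun g => true :: g.code) ++ [false])) := by simpa using hr
    have body := (push_hdr_does true
      { r with inp := g.code ++ (gs.flatMap (fun g => true :: g.code) ++ [false]) }).seq
      ((push_aux_does true _).seq (gate_does wH wT wC g (r := { r with
        inp := g.code ++ (gs.flatMap (fun g => true :: g.code) ++ [false])
        aux := true :: r.aux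
        hdr := true :: r.hdr }) rfl))
    refine (popInp_next hr rfl body (ih rfl)).of_eq_of_le (by simp [List.replicate_succ']) ?_
    simp only [hr, List.length_append, List.length_cons]
    generalize wH.length + wT.length + wC.length = K
    have : 2 * g.code.length ≤ (K + 35) * g.code.length := Nat.mul_le_mul_right _ (by lia)
    simp only [Nat.mul_add, Nat.mul_succ] at this ⊢
    lia

/-- Put the string denoted by a symbol on the stack `out`, where the numbers `N` and `N ^ 2` are
found on the stacks `num` and `sq`. -/
def emitSymbol : Symbol → Prog Reg
  | .bit b => push .out b
  | .num => copy .num .out .tmp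
  | .sq => copy .sq .out .tmp

lemma emitSymbol_does (c : Symbol) {r : Regs} {N : ℕ} (hnum : r.num = N) (hsq : r.sq = N ^ 2) :
    Does (emitSymbol c) r.stk { r with out := c.val N ++ r.out }.stk ((N + N ^ 2) * 4 + 3) := by
  cases c with
  | bit b => exact (push_out_does b r).mono (by lia)
  | num =>
    refine (copy_putsMarks (by decide) (by decide) (by decide) N r.stk
      (by simp [Regs.stk, hnum])).of_eq_of_le ?_ (by lia)
    simp [Regs.update_out, Regs.stk, Symbol.val]
  | sq =>
    refine (copy_putsMarks (by decide) (by decide) (by decide) (N ^ 2) r.stk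
      (by simp [Regs.stk, hsq])).of_eq_of_le ?_ (by lia)
    simp [Regs.update_out, Regs.stk, Symbol.val]

/-- Put the string denoted by a text on the stack `out`. -/
def emitText : List Symbol → Prog Reg
  | [] => skip
  | c :: w => (emitText w).seq (emitSymbol c)

lemma emitText_does (w : List Symbol) {r : Regs} {N : ℕ} (hnum : r.num = N) (hsq : r.sq = N ^ 2) :
    Does (emitText w) r.stk { r with out := w.flatMap (Symbol.val N) ++ r.out }.stk
      (w.length * ((N + N ^ 2) * 4 + 3) + 1) := by
  induction w with
  | nil => exact (skip_does _).mono (by lia)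
  | cons c w ih =>
    exact (ih.seq (emitSymbol_does c hnum hsq)).of_eq_of_le (by simp)
      (by simp only [List.length_cons]; lia)

section Families

variable {ι : Type*} {size : ι → ℕ}

lemma header_doesPoly {r : ι → Regs} {m : ι → ℕ} {x : ι → List Bool}
    (hr : ∀ i, (r i).inp = codeNat (m i) ++ x i) : DoesPoly size header (fun i => (r i).stk)
      fun i => { r i with inp := x i, hdr := List.replicate (m i) true ++ (r i).hdr }.stk :=
  .of_does (fun hS => (PolyBounded.const 2).mul (hS .inp)) fun i => header_does (hr i)

lemma gates_doesPoly {r : ι → Regs} {m : ι → ℕ} {gs : ∀ i, List (StdGate (m i))}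
    (hr : ∀ i, (r i).inp = (gs i).flatMap (fun g => true :: g.code) ++ [false]) :
    DoesPoly size (gates wH wT wC) (fun i => (r i).stk) fun i =>
      { r i with
        inp := []
        aux := ((gs i).flatMap (fun g : StdGate (m i) => true :: g.ctrlCode wH wT wC) ++
          [false]).reverse ++ (r i).aux
        hdr := List.replicate (gs i).length true ++ (r i).hdr }.stk :=
  .of_does (fun hS => (PolyBounded.const _).mul (hS .inp)) fun i =>
    gates_does wH wT wC (gs i) (hr i)

lemma emitText_doesPoly (w : List Symbol) {r : ι → Regs} {N : ι → ℕ} (hnum : ∀ i, (r i).num = N i)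
    (hsq : ∀ i, (r i).sq = N i ^ 2) : DoesPoly size (emitText w) (fun i => (r i).stk)
      fun i => { r i with out := w.flatMap (Symbol.val (N i)) ++ (r i).out }.stk := by
  refine .of_does (fun hS => ?_) fun i => emitText_does w (hnum i) (hsq i)
  have hN : PolyBounded size N := by simpa [Regs.stk, hnum] using hS .num
  exact ((PolyBounded.const w.length).mul (((hN.add (hN.pow 2)).mul (.const 4)).add
    (.const 3))).add (.const 1)

variable (r : ι → Regs)

lemma move_aux_inp_doesPoly : DoesPoly size (move .aux .inp) (fun i => (r i).stk)
    fun i => { r i with aux := [], inp := (r i).aux.reverse ++ (r i).inp }.stk := by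
  simpa [Regs.update_aux, Regs.update_inp, Regs.stk] using
    move_doesPoly (size := size) (a := Reg.aux) (b := .inp) (by decide) (S := fun i => (r i).stk)

lemma move_aux_out_doesPoly : DoesPoly size (move .aux .out) (fun i => (r i).stk)
    fun i => { r i with aux := [], out := (r i).aux.reverse ++ (r i).out }.stk := by
  simpa [Regs.update_aux, Regs.update_out, Regs.stk] using
    move_doesPoly (size := size) (a := Reg.aux) (b := .out) (by decide) (S := fun i => (r i).stk)

lemma move_hdr_out_doesPoly : DoesPoly size (move .hdr .out) (fun i => (r i).stk)
    fun i => { r i with hdr := [], out := (r i).hdr.reverse ++ (r i).out }.stk := by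
  simpa [Regs.update_hdr, Regs.update_out, Regs.stk] using
    move_doesPoly (size := size) (a := Reg.hdr) (b := .out) (by decide) (S := fun i => (r i).stk)

lemma push_out_doesPoly (b : Bool) : DoesPoly size (push .out b) (fun i => (r i).stk)
    fun i => { r i with out := b :: (r i).out }.stk :=
  .of_does (fun _ => .const 1) fun i => push_out_does b (r i)

lemma clear_numbers_doesPoly : DoesPoly size ((clear .num).seq (clear .sq)) (fun i => (r i).stk)
    fun i => { r i with num := 0, sq := 0 }.stk := by
  have num := clear_doesPoly (size := size) Reg.num (S := fun i => (r i).stk)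
  have sq := clear_doesPoly (size := size) Reg.sq (S := fun i => { r i with num := 0 }.stk)
  simp only [← List.replicate_zero (a := true), Regs.update_num, Regs.update_sq] at num sq
  exact num.seq sq

variable (rot : List Symbol) (N : ι → ℕ) (C : ι → Circuit StdGate)

/-- Translate the gates of the circuit whose reversed code is on the stack `aux`. -/
def translateGates : Prog Reg :=
  ((move .aux .inp).seq header).seq ((gates wH wT wC).seq (move .aux .out))

lemma translateGates_doesPoly : DoesPoly size (translateGates wH wT wC)
    (fun i => Regs.stk
      { aux := ((C i).code fun _ g => g.code).reverse, num := N i, sq := N i ^ 2 })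
    fun i => Regs.stk
      { hdr := List.replicate ((C i).gates.length + (C i).numQubits) true
        out := (C i).gates.flatMap (fun g => true :: g.ctrlCode wH wT wC) ++ [false]
        num := N i
        sq := N i ^ 2 } := by
  have read := (move_aux_inp_doesPoly (size := size) fun i =>
      { aux := ((C i).code fun _ g => g.code).reverse, num := N i, sq := N i ^ 2 }).seq
    (header_doesPoly (m := fun i => (C i).numQubits)
      (x := fun i => (C i).gates.flatMap (fun g => true :: g.code) ++ [false])
      fun i => by simp [Circuit.code])
  have rewrite := (gates_doesPoly (size := size) wH wT wC (gs := fun i => (C i).gates)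
    (r := fun i =>
      { inp := (C i).gates.flatMap (fun g => true :: g.code) ++ [false]
        hdr := List.replicate (C i).numQubits true
        num := N i
        sq := N i ^ 2 }) fun i => rfl).seq (move_aux_out_doesPoly _)
  simp only [List.append_nil] at read
  simpa only [translateGates, List.append_nil, List.reverse_reverse,
    List.replicate_append_replicate] using read.seq rewrite

/-- Turn the reversed code of a circuit on the stack `aux` into the code of a circuit whose gates
are the one denoted by `rot` and the controlled gates, on a register with one more qubit for every
gate. -/
def translate : Prog Reg :=
  (translateGates wH wT wC).seq <| (emitText rot).seq <| (push .out false).seq <|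
    (move .hdr .out).seq <| (push .out true).seq <| (clear .num).seq (clear .sq)

lemma translate_doesPoly : DoesPoly size (translate wH wT wC rot)
    (fun i => Regs.stk
      { aux := ((C i).code fun _ g => g.code).reverse, num := N i, sq := N i ^ 2 })
    fun i => Regs.stk
      { out := codeNat ((C i).numQubits + (C i).gates.length + 1) ++
          (rot.flatMap (Symbol.val (N i)) ++
            ((C i).gates.flatMap (fun g => true :: g.ctrlCode wH wT wC) ++ [false])) } := by
  have run := (translateGates_doesPoly (size := size) wH wT wC N C).seq <|
    (emitText_doesPoly rot (fun _ => rfl) fun _ => rfl).seq <| (push_out_doesPoly _ false).seq <|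
    (move_hdr_out_doesPoly _).seq <| (push_out_doesPoly _ true).seq <| clear_numbers_doesPoly _
  simpa [translate, codeNat, List.replicate_succ, Nat.add_comm _ (Circuit.numQubits _)] using run

end Families

end Prog

/-! ### Gates preserve the norm -/

section Extend

variable {ι κ γ : Type*}

lemma extend_extend (f : ι → κ) (y z : ι → γ) (x : κ → γ) :
    Function.extend f y (Function.extend f z x) = Function.extend f y x := by
  funext j
  unfold Function.extend
  split_ifs <;> rfl

lemma extend_comp_self (f : ι → κ) (x : κ → γ) : Function.extend f (x ∘ f) x = x := by
  funext j
  unfold Function.extend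
  split_ifs with hj
  · exact congrArg x hj.choose_spec
  · rfl

/-- The exchange of the values of `x : κ → γ` on the range of `f` with the values of `y : ι → γ`.
Summing over both sides turns a sum over all ways to overwrite `x` into a sum over all `x`. -/
def swapOnRange (f : ι ↪ κ) : (κ → γ) × (ι → γ) ≃ (κ → γ) × (ι → γ) where
  toFun p := (Function.extend f p.2 p.1, p.1 ∘ f)
  invFun p := (Function.extend f p.2 p.1, p.1 ∘ f)
  left_inv p := by
    simp [Function.extend_comp f.injective, extend_extend, extend_comp_self]
  right_inv p := by
    simp [Function.extend_comp f.injective, extend_extend, extend_comp_self]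

lemma sum_sum_extend {M : Type*} [AddCommMonoid M] [Fintype (κ → γ)] [Fintype (ι → γ)]
    (f : ι ↪ κ) (F : (κ → γ) → M) :
    ∑ x, ∑ y : ι → γ, F (Function.extend f y x) = Fintype.card (ι → γ) • ∑ x, F x := by
  calc ∑ x, ∑ y : ι → γ, F (Function.extend f y x)
      = ∑ p : (κ → γ) × (ι → γ), F (swapOnRange f p).1 :=
      (Fintype.sum_prod_type fun p : (κ → γ) × (ι → γ) => F (Function.extend f p.2 p.1)).symm
    _ = ∑ p : (κ → γ) × (ι → γ), F p.1 := (swapOnRange f).sum_comp fun p => F p.1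
    _ = Fintype.card (ι → γ) • ∑ x, F x := by
      simp [Fintype.sum_prod_type, Finset.smul_sum]

end Extend

section Norm

variable {ι : Type*} [Fintype ι]

lemma star_dotProduct_self (v : ι → ℂ) : star v ⬝ᵥ v = ((∑ i, ‖v i‖ ^ 2 : ℝ) : ℂ) := by
  simp [dotProduct, Complex.conj_mul']

lemma sum_norm_sq_mulVec [DecidableEq ι] {U : Matrix ι ι ℂ}
    (hU : U ∈ Matrix.unitaryGroup ι ℂ) (v : ι → ℂ) :
    ∑ i, ‖U.mulVec v i‖ ^ 2 = ∑ i, ‖v i‖ ^ 2 := by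
  have h : star (U.mulVec v) ⬝ᵥ U.mulVec v = star v ⬝ᵥ v := by
    rw [Matrix.star_mulVec, Matrix.dotProduct_mulVec, Matrix.vecMul_vecMul,
      ← Matrix.star_eq_conjTranspose, Matrix.mem_unitaryGroup_iff'.1 hU, Matrix.vecMul_one]
  rw [star_dotProduct_self, star_dotProduct_self] at h
  exact_mod_cast h

end Norm

namespace Gate

variable {n : ℕ}

lemma apply_extend (g : Gate n) (ψ : State n) (x : Fin n → Bool) (y : Fin g.arity → Bool) :
    g.apply ψ (Function.extend g.wires y x) =
      g.mat.mulVec (fun z => ψ (Function.extend g.wires z x)) y := by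
  simp only [apply, Function.extend_comp g.wires.injective, extend_extend]
  rfl

lemma sum_norm_sq_apply (g : Gate n) (ψ : State n) :
    ∑ x, ‖g.apply ψ x‖ ^ 2 = ∑ x, ‖ψ x‖ ^ 2 := by
  have h : Fintype.card (Fin g.arity → Bool) • ∑ x, ‖g.apply ψ x‖ ^ 2 =
      Fintype.card (Fin g.arity → Bool) • ∑ x, ‖ψ x‖ ^ 2 := by
    rw [← sum_sum_extend g.wires fun x => ‖g.apply ψ x‖ ^ 2,
      ← sum_sum_extend g.wires fun x => ‖ψ x‖ ^ 2]
    refine Finset.sum_congr rfl fun x _ => ?_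
    simp only [apply_extend]
    exact sum_norm_sq_mulVec g.unitary _
  exact smul_right_injective ℝ Fintype.card_ne_zero h

end Gate

lemma sum_norm_sq_zeroState (n : ℕ) : ∑ x, ‖zeroState n x‖ ^ 2 = 1 := by
  rw [Fintype.sum_eq_single fun _ => false]
  · simp [zeroState]
  · intro x hx
    simp [zeroState, hx]

lemma sum_norm_sq_finalState {n : ℕ} (gs : List (Gate n)) :
    ∑ x, ‖finalState gs x‖ ^ 2 = 1 := by
  have h : ∀ ψ : State n, ∑ x, ‖gs.foldl (fun ψ g => g.apply ψ) ψ x‖ ^ 2 = ∑ x, ‖ψ x‖ ^ 2 := by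
    induction gs with
    | nil => exact fun ψ => rfl
    | cons g gs ih => exact fun ψ => (ih _).trans (g.sum_norm_sq_apply ψ)
  exact (h _).trans (sum_norm_sq_zeroState n)

/-! ### Trace distance of pure states -/

section TraceNorm

variable {ι : Type} [Fintype ι]

open scoped ComplexOrder in
lemma traceNorm_sq_le [DecidableEq ι] (A : Matrix ι ι ℂ) :
    traceNorm A ^ 2 ≤ A.rank * (Matrix.trace (A.conjTranspose * A)).re := by
  have hA := Matrix.isHermitian_conjTranspose_mul_self A
  have eigenvalues_nonneg : ∀ i, 0 ≤ hA.eigenvalues i :=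
    (Matrix.posSemidef_conjTranspose_mul_self A).eigenvalues_nonneg
  let s := Finset.univ.filter fun i => hA.eigenvalues i ≠ 0
  have rank_eq : A.rank = s.card := by
    rw [← Matrix.rank_conjTranspose_mul_self, hA.rank_eq_card_non_zero_eigs, Fintype.card_subtype]
  have traceNorm_eq : traceNorm A = ∑ i ∈ s, √(hA.eigenvalues i) := by
    refine (Finset.sum_subset s.subset_univ fun i _ hi => ?_).symm
    simp_all [s]
  have trace_eq : (Matrix.trace (A.conjTranspose * A)).re = ∑ i ∈ s, √(hA.eigenvalues i) ^ 2 := by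
    have : (Matrix.trace (A.conjTranspose * A)).re = ∑ i, hA.eigenvalues i := by
      simp [hA.trace_eq_sum_eigenvalues]
    rw [this, ← Finset.sum_subset s.subset_univ fun i _ hi => by simp_all [s]]
    exact Finset.sum_congr rfl fun i _ => (Real.sq_sqrt (eigenvalues_nonneg i)).symm
  rw [traceNorm_eq, trace_eq, rank_eq]
  exact sq_sum_le_card_mul_sum_sq -- Cauchy–Schwarz over the nonzero singular values

lemma rank_vecMulVec_sub_vecMulVec_le (u v u' v' : ι → ℂ) :
    (Matrix.vecMulVec u v - Matrix.vecMulVec u' v').rank ≤ 2 := by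
  have factor : Matrix.vecMulVec u v - Matrix.vecMulVec u' v' =
      (Matrix.of fun x (j : Fin 2) => ![u x, u' x] j) *
        Matrix.of fun (j : Fin 2) y => ![v y, -v' y] j := by
    ext x y
    simp [Matrix.mul_apply, Matrix.vecMulVec_apply, sub_eq_add_neg]
  rw [factor]
  exact (Matrix.rank_mul_le_left _ _).trans ((Matrix.rank_le_card_width _).trans (by simp))

end TraceNorm

section TraceDist

variable {n : ℕ}

lemma conjTranspose_density (φ : State n) : (density φ).conjTranspose = density φ := by
  rw [density, Matrix.conjTranspose_vecMulVec, star_star]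

lemma trace_density_mul_density (ψ φ : State n) :
    Matrix.trace (density ψ * density φ) = ((‖star ψ ⬝ᵥ φ‖ ^ 2 : ℝ) : ℂ) := by
  have h : star φ ⬝ᵥ ψ = star (star ψ ⬝ᵥ φ) := Matrix.star_dotProduct φ ψ
  simp only [density, Matrix.vecMulVec_mul_vecMulVec, Matrix.trace_vecMulVec, smul_eq_mul,
    dotProduct_smul, dotProduct_comm ψ (star φ), h]
  rw [Complex.star_def, Complex.mul_conj']
  push_cast
  rfl

open scoped ComplexOrder in
lemma traceDist_le_sqrt {ψ φ : State n} (hψ : ∑ x, ‖ψ x‖ ^ 2 = 1) (hφ : ∑ x, ‖φ x‖ ^ 2 = 1) :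
    traceDist ψ φ ≤ √(1 - ‖star ψ ⬝ᵥ φ‖ ^ 2) := by
  have trace_eq : (Matrix.trace ((density ψ - density φ).conjTranspose *
      (density ψ - density φ))).re = 2 * (1 - ‖star ψ ⬝ᵥ φ‖ ^ 2) := by
    rw [Matrix.conjTranspose_sub, conjTranspose_density, conjTranspose_density, sub_mul, mul_sub,
      mul_sub, Matrix.trace_sub, Matrix.trace_sub, Matrix.trace_sub,
      Matrix.trace_mul_comm (density φ) (density ψ)]
    simp only [trace_density_mul_density, star_dotProduct_self, hψ, hφ, ← Complex.ofReal_sub,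
      Complex.ofReal_re, Complex.norm_real]
    norm_num
    ring
  have trace_nonneg : 0 ≤ (Matrix.trace ((density ψ - density φ).conjTranspose *
      (density ψ - density φ))).re :=
    (Complex.le_def.1 (Matrix.posSemidef_conjTranspose_mul_self _).trace_nonneg).1
  have rank_le : ((density ψ - density φ).rank : ℝ) ≤ 2 := by
    exact_mod_cast rank_vecMulVec_sub_vecMulVec_le ψ (star ψ) φ (star φ)
  have traceNorm_sq : traceNorm (density ψ - density φ) ^ 2 ≤
      2 ^ 2 * (1 - ‖star ψ ⬝ᵥ φ‖ ^ 2) := by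
    have := mul_le_mul_of_nonneg_right rank_le trace_nonneg
    linarith [traceNorm_sq_le (density ψ - density φ)]
  refine Real.le_sqrt_of_sq_le ?_
  rw [traceDist, mul_pow]
  linarith

end TraceDist

/-! ### Exact descriptions of gates -/

lemma cyclo_zero : cyclo 0 = 0 := by simp [cyclo]

lemma cyclo_vec (a b c d : ℚ) :
    cyclo ![a, b, c, d] = a + b * zeta + c * zeta ^ 2 + d * zeta ^ 3 := by
  simp [cyclo, Fin.sum_univ_four]

lemma zeta_eq : zeta = (√2 / 2 : ℝ) + (√2 / 2 : ℝ) * Complex.I := by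
  rw [zeta, Complex.exp_mul_I, ← Complex.ofReal_cos, ← Complex.ofReal_sin, Real.cos_pi_div_four,
    Real.sin_pi_div_four]

lemma sqrt_two_sq : ((√2 : ℝ) : ℂ) ^ 2 = 2 := by
  exact_mod_cast congrArg Complex.ofReal (Real.sq_sqrt zero_le_two)

lemma zeta_sq : zeta ^ 2 = Complex.I := by
  rw [zeta_eq]
  push_cast
  linear_combination (1 / 4 * (1 + 2 * Complex.I + Complex.I ^ 2)) * sqrt_two_sq +
    (1 / 2) * Complex.I_sq

lemma zeta_sub_zeta_cube : zeta - zeta ^ 3 = (√2 : ℝ) := by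
  rw [pow_succ, zeta_sq, zeta_eq]
  push_cast
  linear_combination (-((√2 : ℝ) : ℂ) / 2) * Complex.I_sq

/-- The gate with matrix `U` on the wires `w`, described by the coefficients `coeff` of `U`. -/
def ExactGate.ofCoeff {n k : ℕ} (hk : k ≤ 3) (w : Fin k ↪ Fin n)
    (coeff : (Fin k → Bool) → (Fin k → Bool) → Fin 4 → ℚ) {U : QubitMatrix k}
    (hU : U ∈ Matrix.unitaryGroup (Fin k → Bool) ℂ)
    (h : (Matrix.of fun x y => cyclo (coeff x y)) = U) : ExactGate n :=
  ⟨k, hk, w, coeff, h ▸ hU⟩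

lemma ExactGate.toGate_ofCoeff {n k : ℕ} (hk : k ≤ 3) (w : Fin k ↪ Fin n)
    (coeff : (Fin k → Bool) → (Fin k → Bool) → Fin 4 → ℚ) {U : QubitMatrix k}
    (hU : U ∈ Matrix.unitaryGroup (Fin k → Bool) ℂ)
    (h : (Matrix.of fun x y => cyclo (coeff x y)) = U) :
    (ofCoeff hk w coeff hU h).toGate = ⟨k, hk, w, U, hU⟩ := by
  subst h
  rfl

/-- The coefficients of the Hadamard gate, since `1 / √2 = (ζ - ζ ^ 3) / 2`. -/
def hadamardCoeff (x y : Fin 1 → Bool) : Fin 4 → ℚ :=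
  if x 0 && y 0 then ![0, -1 / 2, 0, 1 / 2] else ![0, 1 / 2, 0, -1 / 2]

/-- The coefficients of the phase gate. -/
def phaseTCoeff (x y : Fin 1 → Bool) : Fin 4 → ℚ :=
  if x = y then if x 0 then ![0, 1, 0, 0] else ![1, 0, 0, 0] else 0

/-- The coefficients of the CNOT gate. -/
def cnotCoeff (x y : Fin 2 → Bool) : Fin 4 → ℚ :=
  if x 0 = y 0 ∧ x 1 = xor (y 0) (y 1) then ![1, 0, 0, 0] else 0

lemma of_cyclo_hadamardCoeff : (Matrix.of fun x y => cyclo (hadamardCoeff x y)) = hadamard := by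
  have inv_sqrt_two : 1 / ((√2 : ℝ) : ℂ) = (zeta - zeta ^ 3) / 2 := by
    rw [zeta_sub_zeta_cube, div_eq_div_iff (by simp) two_ne_zero]
    linear_combination -sqrt_two_sq
  ext x y
  rw [Matrix.of_apply, hadamard, hadamardCoeff]
  split_ifs <;> rw [cyclo_vec] <;> push_cast
  · linear_combination inv_sqrt_two
  · linear_combination -inv_sqrt_two

lemma of_cyclo_phaseTCoeff : (Matrix.of fun x y => cyclo (phaseTCoeff x y)) = phaseT := by
  ext x y
  rw [Matrix.of_apply, phaseT, phaseTCoeff, Matrix.diagonal_apply]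
  split_ifs <;> simp [cyclo_vec, cyclo_zero]

lemma of_cyclo_cnotCoeff : (Matrix.of fun x y => cyclo (cnotCoeff x y)) = cnot := by
  ext x y
  rw [Matrix.of_apply, cnot, cnotCoeff]
  split_ifs <;> simp [cyclo_vec, cyclo_zero]

/-- The exact description of a letter of the universal gate set. -/
def StdGate.toExact {n : ℕ} : StdGate n → ExactGate n
  | .h i => .ofCoeff (by norm_num) (wire1 i) hadamardCoeff hadamard_unitary of_cyclo_hadamardCoeff
  | .t i => .ofCoeff (by norm_num) (wire1 i) phaseTCoeff phaseT_unitary of_cyclo_phaseTCoeff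
  | .cx a b ne => .ofCoeff (by norm_num) (wire2 a b ne) cnotCoeff cnot_unitary of_cyclo_cnotCoeff

lemma StdGate.toGate_toExact {n : ℕ} (g : StdGate n) : g.toExact.toGate = g.toGate := by
  cases g
  · exact ExactGate.toGate_ofCoeff _ _ _ _ of_cyclo_hadamardCoeff
  · exact ExactGate.toGate_ofCoeff _ _ _ _ of_cyclo_phaseTCoeff
  · exact ExactGate.toGate_ofCoeff _ _ _ _ of_cyclo_cnotCoeff

lemma StdGate.arity_toExact_le {n : ℕ} (g : StdGate n) : g.toExact.arity ≤ 2 := by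
  cases g <;> simp [toExact, ExactGate.ofCoeff]

/-! ### Controlled gates -/

section ControlledMatrix

variable {k : ℕ}

lemma sum_fin_succ_bool {M : Type*} [AddCommMonoid M] (F : (Fin (k + 1) → Bool) → M) :
    ∑ y, F y = ∑ z : Fin k → Bool, F (Fin.cons true z) + ∑ z : Fin k → Bool,
      F (Fin.cons false z) := by
  rw [← (Fin.consEquiv fun _ => Bool).sum_comp, Fintype.sum_prod_type, Fintype.sum_bool]
  rfl

/-- The matrix of the gate `U` controlled by a further qubit, which comes first. -/
def ctrlMat (U : QubitMatrix k) : QubitMatrix (k + 1) := fun x y =>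
  if x 0 = y 0 then
    if x 0 then U (Fin.tail x) (Fin.tail y) else if Fin.tail x = Fin.tail y then 1 else 0
  else 0

lemma ctrlMat_unitary {U : QubitMatrix k} (hU : U ∈ Matrix.unitaryGroup (Fin k → Bool) ℂ) :
    ctrlMat U ∈ Matrix.unitaryGroup (Fin (k + 1) → Bool) ℂ := by
  rw [Matrix.mem_unitaryGroup_iff] at hU ⊢
  ext x y
  have entry := congrFun (congrFun hU (Fin.tail x)) (Fin.tail y)
  cases x using Fin.consCases with | _ a x
  cases y using Fin.consCases with | _ b y
  simp only [Fin.tail_cons, Matrix.mul_apply, Matrix.one_apply, Matrix.star_apply] at entry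
  simp only [Matrix.mul_apply, Matrix.one_apply, Matrix.star_apply, sum_fin_succ_bool,
    Fin.cons_inj]
  cases a <;> cases b <;> simp [ctrlMat]
  simpa using entry

/-- The coefficients of the controlled gate. -/
def ctrlCoeff (c : (Fin k → Bool) → (Fin k → Bool) → Fin 4 → ℚ) (x y : Fin (k + 1) → Bool) :
    Fin 4 → ℚ :=
  if x 0 = y 0 then
    if x 0 then c (Fin.tail x) (Fin.tail y)
    else if Fin.tail x = Fin.tail y then ![1, 0, 0, 0] else 0
  else 0

lemma of_cyclo_ctrlCoeff (c : (Fin k → Bool) → (Fin k → Bool) → Fin 4 → ℚ) :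
    (Matrix.of fun x y => cyclo (ctrlCoeff c x y)) =
      ctrlMat (Matrix.of fun x y => cyclo (c x y)) := by
  ext x y
  simp only [Matrix.of_apply, ctrlCoeff, ctrlMat]
  split_ifs <;> simp [cyclo_vec, cyclo_zero]

end ControlledMatrix

section Plug

variable {m n : ℕ} (f : Fin m ↪ Fin n) (c : Fin n)

/-- The basis state `y` of the register embedded by `f`, with the control qubit `c` set to `1` and
all remaining qubits set to `0`. -/
def plug (y : Fin m → Bool) : Fin n → Bool := Function.extend f y fun j => decide (j = c)

lemma plug_injective : Function.Injective (plug f c) := Function.extend_injective f.injective _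

lemma plug_apply (y : Fin m → Bool) (i : Fin m) : plug f c y (f i) = y i :=
  f.injective.extend_apply _ _ _

variable {f} in
lemma plug_apply_of_notMem_range {j : Fin n} (hj : ¬∃ i, f i = j) (y : Fin m → Bool) :
    plug f c y j = decide (j = c) := Function.extend_apply' _ _ _ hj

lemma extend_trans_plug {k : ℕ} (w : Fin k ↪ Fin m) (z : Fin k → Bool) (y : Fin m → Bool) :
    Function.extend (w.trans f) z (plug f c y) = plug f c (Function.extend w z y) := by
  funext j
  by_cases hj : ∃ i, f i = j
  · obtain ⟨i, rfl⟩ := hj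
    rw [plug_apply]
    by_cases hi : ∃ l, w l = i
    · obtain ⟨l, rfl⟩ := hi
      rw [w.injective.extend_apply]
      exact (w.trans f).injective.extend_apply _ _ l
    · rw [Function.extend_apply' _ _ _ hi, Function.extend_apply' _ _ _, plug_apply]
      exact fun ⟨l, hl⟩ => hi ⟨l, f.injective hl⟩
  · rw [plug_apply_of_notMem_range c hj, Function.extend_apply' _ _ _,
      plug_apply_of_notMem_range c hj]
    exact fun ⟨l, hl⟩ => hj ⟨w l, hl⟩

variable {f c}

lemma plug_apply_control (hc : ∀ i, f i ≠ c) (y : Fin m → Bool) : plug f c y c = true := by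
  rw [plug_apply_of_notMem_range c fun ⟨i, hi⟩ => hc i hi, decide_eq_true rfl]

lemma plug_zero (hc : ∀ i, f i ≠ c) :
    plug f c (fun _ => false) = Function.update (fun _ => false) c true := by
  funext j
  by_cases hj : ∃ i, f i = j
  · obtain ⟨i, rfl⟩ := hj
    rw [plug_apply, Function.update_of_ne (hc i)]
  · rw [plug_apply_of_notMem_range c hj]
    by_cases hjc : j = c <;> simp [hjc]

lemma extend_plug_zeroState (hc : ∀ i, f i ≠ c) :
    Function.extend (plug f c) (zeroState m) 0 =
      Pi.single (Function.update (fun _ => false) c true) 1 := by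
  rw [← plug_zero hc]
  funext x
  by_cases hx : ∃ y, plug f c y = x
  · obtain ⟨y, rfl⟩ := hx
    simp [(plug_injective f c).extend_apply, zeroState, Pi.single_apply,
      (plug_injective f c).eq_iff]
  · rw [Function.extend_apply' _ _ _ hx, Pi.single_eq_of_ne fun h => hx ⟨_, h.symm⟩]
    rfl

end Plug

namespace Gate

variable {n : ℕ} (g : Gate n)

lemma apply_add (ψ φ : State n) : g.apply (ψ + φ) = g.apply ψ + g.apply φ := by
  funext x
  simp [apply, mul_add, Finset.sum_add_distrib]

lemma apply_smul (a : ℂ) (ψ : State n) : g.apply (a • ψ) = a • g.apply ψ := by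
  funext x
  simp [apply, Finset.mul_sum, mul_left_comm]

end Gate

section Controlled

variable {m n : ℕ} (f : Fin m ↪ Fin n) (c : Fin n) (hc : ∀ i, f i ≠ c)

/-- The wires of a controlled gate: the control qubit `c`, and the wires of the gate on the
register that is embedded by `f`. -/
def ctrlWires {k : ℕ} (w : Fin k ↪ Fin m) : Fin (k + 1) ↪ Fin n :=
  ⟨Fin.cons c (f ∘ w), Fin.cons_injective_iff.2
    ⟨fun ⟨i, hi⟩ => hc (w i) hi, f.injective.comp w.injective⟩⟩

lemma extend_ctrlWires {k : ℕ} (w : Fin k ↪ Fin m) {b : Bool} (z : Fin k → Bool)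
    {x : Fin n → Bool} (hx : x c = b) :
    Function.extend (ctrlWires f c hc w) (Fin.cons b z) x = Function.extend (w.trans f) z x := by
  funext j
  by_cases hj : ∃ i, w.trans f i = j
  · obtain ⟨i, rfl⟩ := hj
    rw [(w.trans f).injective.extend_apply]
    exact (ctrlWires f c hc w).injective.extend_apply _ _ i.succ
  rw [Function.extend_apply' _ _ _ hj]
  by_cases hjc : c = j
  · subst hjc hx
    exact (ctrlWires f c hc w).injective.extend_apply _ _ 0
  · refine Function.extend_apply' _ _ _ fun ⟨i, hi⟩ => ?_
    cases i using Fin.cases with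
    | zero => exact hjc hi
    | succ i => exact hj ⟨i, hi⟩

/-- The gate `g` on the register embedded by `f`, controlled by the qubit `c`. -/
def Gate.controlled (g : Gate m) (hg : g.arity ≤ 2) : Gate n :=
  ⟨g.arity + 1, by lia, ctrlWires f c hc g.wires, ctrlMat g.mat, ctrlMat_unitary g.unitary⟩

/-- The exact description of a controlled gate. -/
def ExactGate.controlled (g : ExactGate m) (hg : g.arity ≤ 2) : ExactGate n :=
  .ofCoeff (by lia) (ctrlWires f c hc g.wires) (ctrlCoeff g.coeff) (ctrlMat_unitary g.unitary)
    (of_cyclo_ctrlCoeff g.coeff)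

lemma ExactGate.toGate_controlled (g : ExactGate m) (hg : g.arity ≤ 2) :
    (g.controlled f c hc hg).toGate = g.toGate.controlled f c hc hg :=
  toGate_ofCoeff _ _ _ _ (of_cyclo_ctrlCoeff g.coeff)

lemma Gate.controlled_apply (g : Gate m) (hg : g.arity ≤ 2) (Ψ : State n) (x : Fin n → Bool) :
    (g.controlled f c hc hg).apply Ψ x =
      if x c then ∑ z, g.mat (x ∘ g.wires.trans f) z * Ψ (Function.extend (g.wires.trans f) z x)
      else Ψ x := by
  have head : (x ∘ ctrlWires f c hc g.wires) 0 = x c := rfl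
  have tail : Fin.tail (x ∘ ctrlWires f c hc g.wires) = x ∘ g.wires.trans f := rfl
  rw [Gate.apply, controlled, sum_fin_succ_bool]
  simp only [ctrlMat, head, tail, Fin.cons_zero, Fin.tail_cons]
  cases hx : x c
  · simp [extend_ctrlWires f c hc _ _ hx, extend_comp_self]
  · simp [extend_ctrlWires f c hc _ _ hx]

variable {f c}

lemma Gate.controlled_apply_zeroState (g : Gate m) (hg : g.arity ≤ 2) :
    (g.controlled f c hc hg).apply (zeroState n) = zeroState n := by
  have zero_of_control : ∀ x : Fin n → Bool, x c = true → zeroState n x = 0 := fun x hx =>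
    Pi.single_eq_of_ne (by rintro rfl; simp at hx) _
  funext x
  rw [controlled_apply]
  split_ifs with hx
  · refine (Finset.sum_eq_zero fun z _ => ?_).trans (zero_of_control x hx).symm
    rw [zero_of_control, mul_zero]
    rwa [Function.extend_apply' _ _ _ fun ⟨i, hi⟩ => hc _ hi]
  · rfl

lemma Gate.controlled_apply_extend_plug (g : Gate m) (hg : g.arity ≤ 2) (ψ : State m) :
    (g.controlled f c hc hg).apply (Function.extend (plug f c) ψ 0) =
      Function.extend (plug f c) (g.apply ψ) 0 := by
  have plug_inj := plug_injective f c
  funext x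
  rw [controlled_apply]
  by_cases hx : ∃ y, plug f c y = x
  · obtain ⟨y, rfl⟩ := hx
    have wires : plug f c y ∘ g.wires.trans f = y ∘ g.wires :=
      funext fun i => plug_apply f c y (g.wires i)
    simp only [plug_apply_control hc, if_true, wires, extend_trans_plug, plug_inj.extend_apply,
      Gate.apply]
  · have off_range : ∀ z, ¬∃ y, plug f c y = Function.extend (g.wires.trans f) z x := by
      rintro z ⟨y, hy⟩
      refine hx ⟨Function.extend g.wires (x ∘ g.wires.trans f) y, ?_⟩
      rw [← extend_trans_plug, hy, extend_extend, extend_comp_self]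
    simp [Function.extend_apply' _ _ _ (off_range _), Function.extend_apply' _ _ _ hx]

/-- The superposition of `|0⟩` with amplitude `α` and, with amplitude `β`, the state `ψ` of the
register embedded by `f`, next to a control qubit `c` in the state `|1⟩`. -/
def branchState (f : Fin m ↪ Fin n) (c : Fin n) (α β : ℂ) (ψ : State m) : State n :=
  α • zeroState n + β • Function.extend (plug f c) ψ 0

lemma Gate.controlled_apply_branchState (g : Gate m) (hg : g.arity ≤ 2) (α β : ℂ) (ψ : State m) :
    (g.controlled f c hc hg).apply (branchState f c α β ψ) =
      branchState f c α β (g.apply ψ) := by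
  rw [branchState, apply_add, apply_smul, apply_smul, controlled_apply_zeroState,
    controlled_apply_extend_plug, branchState]

include hc

lemma star_branchState_dotProduct_zeroState (α β : ℂ) (ψ : State m) :
    star (branchState f c α β ψ) ⬝ᵥ zeroState n = star α := by
  have off_range : ¬∃ y, plug f c y = fun _ => false := fun ⟨y, hy⟩ => by
    simpa [hy] using plug_apply_control hc y
  simp [zeroState, branchState, Function.extend_apply' _ _ _ off_range]

lemma probOne_branchState (α β : ℂ) (ψ : State m) (i : Fin m) :
    probOne (branchState f c α β ψ) (f i) = ‖β‖ ^ 2 * probOne ψ i := by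
  have plug_inj := plug_injective f c
  rw [probOne, probOne, Finset.mul_sum]
  refine (Fintype.sum_of_injective (plug f c) plug_inj _ _ (fun x hx => ?_) fun y => ?_).symm
  · rw [branchState, Pi.add_apply, Pi.smul_apply, Pi.smul_apply, Function.extend_apply' _ _ _ hx]
    by_cases hx0 : x = fun _ => false
    · simp [hx0]
    · simp [zeroState, hx0]
  · have ne_zero : plug f c y ≠ fun _ => false := fun h => by
      simpa [h] using plug_apply_control hc y
    simp [branchState, zeroState, ne_zero, plug_apply, plug_inj.extend_apply, mul_pow]

end Controlled

/-! ### The small rotation -/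

/-- The diagonal entries of the small rotation. -/
def rotDiag (N : ℕ) : ℂ := N / (N - Complex.I)

/-- The off-diagonal entries of the small rotation. -/
def rotOff (N : ℕ) : ℂ := -Complex.I / (N - Complex.I)

lemma natCast_sub_I_ne_zero (N : ℕ) : (N : ℂ) - Complex.I ≠ 0 := fun h => by
  simpa using congrArg Complex.im h

lemma norm_natCast_sub_I_sq (N : ℕ) : ‖(N : ℂ) - Complex.I‖ ^ 2 = N ^ 2 + 1 := by
  rw [← Complex.normSq_eq_norm_sq, Complex.normSq_apply]
  simp
  ring

lemma norm_rotOff_sq (N : ℕ) : ‖rotOff N‖ ^ 2 = 1 / ((N : ℝ) ^ 2 + 1) := by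
  rw [rotOff, norm_div, div_pow, norm_natCast_sub_I_sq, norm_neg, Complex.norm_I, one_pow]

lemma norm_rotDiag_sq (N : ℕ) : ‖rotDiag N‖ ^ 2 = (N : ℝ) ^ 2 / ((N : ℝ) ^ 2 + 1) := by
  rw [rotDiag, norm_div, div_pow, norm_natCast_sub_I_sq, Complex.norm_natCast]

/-- The unitary matrix `(N - i X) / (N - i)`, where `X` is the NOT gate; it is close to the
identity for large `N`. -/
def rotMat (N : ℕ) : QubitMatrix 1 := fun x y => if x 0 = y 0 then rotDiag N else rotOff N

lemma rotMat_unitary (N : ℕ) : rotMat N ∈ Matrix.unitaryGroup (Fin 1 → Bool) ℂ := by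
  have norm_row : rotDiag N * star (rotDiag N) + rotOff N * star (rotOff N) = 1 := by
    rw [Complex.star_def, Complex.mul_conj', Complex.mul_conj']
    norm_cast
    rw [norm_rotDiag_sq, norm_rotOff_sq]
    field_simp
  have orthogonal : rotDiag N * star (rotOff N) + rotOff N * star (rotDiag N) = 0 := by
    simp only [rotDiag, rotOff, Complex.star_def, map_div₀, map_neg, Complex.conj_natCast,
      Complex.conj_I]
    ring
  rw [Matrix.mem_unitaryGroup_iff]
  ext x y
  have ext_iff : x = y ↔ x 0 = y 0 := by simp [funext_iff, Fin.forall_fin_one]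
  rw [Matrix.mul_apply, ← (Equiv.funUnique (Fin 1) Bool).symm.sum_comp, Fintype.sum_bool,
    Matrix.one_apply]
  simp only [Matrix.star_apply, rotMat, ext_iff]
  cases x 0 <;> cases y 0 <;>
    simp [Equiv.funUnique, -Complex.star_def, -RCLike.star_def, norm_row, orthogonal,
      add_comm (rotOff N * _)]

/-- The coefficients of the small rotation. -/
def rotCoeff (N : ℕ) (x y : Fin 1 → Bool) : Fin 4 → ℚ :=
  if x 0 = y 0 then ![N ^ 2 / (N ^ 2 + 1), 0, N / (N ^ 2 + 1), 0]
  else ![1 / (N ^ 2 + 1), 0, -N / (N ^ 2 + 1), 0]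

lemma of_cyclo_rotCoeff (N : ℕ) : (Matrix.of fun x y => cyclo (rotCoeff N x y)) = rotMat N := by
  have denom_ne_zero : (N : ℂ) ^ 2 + 1 ≠ 0 := by exact_mod_cast Nat.succ_ne_zero (N ^ 2)
  have := natCast_sub_I_ne_zero N
  ext x y
  rw [Matrix.of_apply, rotCoeff, rotMat]
  split_ifs <;> rw [cyclo_vec, zeta_sq]
  · rw [rotDiag]
    push_cast
    field_simp
    linear_combination (-N : ℂ) * Complex.I_sq
  · rw [rotOff]
    push_cast
    field_simp
    linear_combination (N : ℂ) * Complex.I_sq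

/-- The small rotation of the qubit `c`. -/
def rotation {n : ℕ} (c : Fin n) (N : ℕ) : ExactGate n :=
  .ofCoeff (by norm_num) (wire1 c) (rotCoeff N) (rotMat_unitary N) (of_cyclo_rotCoeff N)

lemma extend_wire1 {n : ℕ} (c : Fin n) (y : Fin 1 → Bool) (x : Fin n → Bool) :
    Function.extend (wire1 c) y x = Function.update x c (y 0) := by
  funext j
  by_cases hj : j = c
  · subst hj
    rw [Function.update_self]
    exact (wire1 j).injective.extend_apply _ _ 0
  · rw [Function.update_of_ne hj]
    exact Function.extend_apply' _ _ _ fun ⟨_, h⟩ => hj h.symm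

lemma rotation_apply_zeroState {m n : ℕ} {f : Fin m ↪ Fin n} {c : Fin n} (hc : ∀ i, f i ≠ c)
    (N : ℕ) : (rotation c N).toGate.apply (zeroState n) =
      branchState f c (rotDiag N) (rotOff N) (zeroState m) := by
  funext x
  have eq_update : ∀ b, x = Function.update (fun _ => false) c b ↔
      x c = b ∧ ∀ j ≠ c, x j = false := fun b => by simp [Function.eq_update_iff]
  have update_eq : ∀ b, Function.update x c b = (fun _ => false) ↔
      b = false ∧ ∀ j ≠ c, x j = false := fun b => by simp [Function.update_eq_iff]
  have eq_zero := eq_update false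
  rw [Function.update_eq_self_iff.2 rfl] at eq_zero
  have control : (x ∘ wire1 c) 0 = x c := rfl
  rw [rotation, ExactGate.toGate_ofCoeff, Gate.apply,
    ← (Equiv.funUnique (Fin 1) Bool).symm.sum_comp, Fintype.sum_bool, branchState,
    extend_plug_zeroState hc]
  simp only [extend_wire1, Equiv.funUnique, zeroState, Pi.single_apply, update_eq, eq_update,
    eq_zero, Pi.add_apply, Pi.smul_apply, rotMat, control]
  cases x c <;> simp

/-! ### Independent runs -/

/-- The expectation of a function of the number of outcomes `1` in `N` independent runs, each of
which gives `1` with probability `q`. -/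
def countExp (q : ℝ) (N : ℕ) (F : ℕ → ℝ) : ℝ :=
  ∑ o : Fin N → Bool, (∏ i, if o i then q else 1 - q) * F ((List.ofFn o).count true)

lemma countExp_succ (q : ℝ) (N : ℕ) (F : ℕ → ℝ) :
    countExp q (N + 1) F = q * countExp q N (fun c => F (c + 1)) + (1 - q) * countExp q N F := by
  rw [countExp, sum_fin_succ_bool, countExp, countExp, Finset.mul_sum, Finset.mul_sum]
  congr 1 <;> refine Finset.sum_congr rfl fun o _ => ?_ <;>
    simp [Fin.prod_univ_succ, List.ofFn_succ, mul_assoc]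

lemma countExp_one (q : ℝ) (N : ℕ) : countExp q N (fun _ => 1) = 1 := by
  induction N with
  | zero => simp [countExp]
  | succ N ih => rw [countExp_succ, ih]; ring

lemma countExp_sub_sq (q : ℝ) (N : ℕ) (a : ℝ) :
    countExp q N (fun c => (c - a) ^ 2) = N * q * (1 - q) + (N * q - a) ^ 2 := by
  induction N generalizing a with
  | zero => simp [countExp]
  | succ N ih =>
    have hshift : (fun c : ℕ => (((c + 1 : ℕ) : ℝ) - a) ^ 2) = fun c : ℕ => (c - (a - 1)) ^ 2 := by
      funext c
      push_cast
      ring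
    rw [countExp_succ, hshift, ih, ih]
    push_cast
    ring

lemma probRuns_add_probRuns_not (q : ℝ) (N : ℕ) (post : List Bool → Bool) :
    probRuns q N post + probRuns q N (fun o => !post o) = 1 := by
  rw [← countExp_one q N, probRuns, probRuns, countExp, ← Finset.sum_add_distrib]
  refine Finset.sum_congr rfl fun o _ => ?_
  cases post (List.ofFn o) <;> simp

section Chebyshev

variable {q : ℝ} (hq₀ : 0 ≤ q) (hq₁ : q ≤ 1)
include hq₀ hq₁

lemma sq_mul_probRuns_le (N : ℕ) {post : List Bool → Bool} {t : ℝ}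
    (h : ∀ o, post o = true → t ^ 2 ≤ ((o.count true : ℕ) - N * q) ^ 2) :
    t ^ 2 * probRuns q N post ≤ N * q := by
  have hle_var : t ^ 2 * probRuns q N post ≤ countExp q N fun c => (c - N * q) ^ 2 := by
    rw [probRuns, countExp, Finset.mul_sum]
    refine Finset.sum_le_sum fun o _ => ?_
    have hprob : 0 ≤ ∏ i, (if o i then q else 1 - q) :=
      Finset.prod_nonneg fun i _ => by split_ifs <;> linarith
    by_cases ho : post (List.ofFn o) = true
    · rw [if_pos ho, mul_comm]
      exact mul_le_mul_of_nonneg_left (h _ ho) hprob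
    · rw [if_neg ho, mul_zero]
      exact mul_nonneg hprob (sq_nonneg _)
  rw [countExp_sub_sq, sub_self] at hle_var
  nlinarith [mul_nonneg (Nat.cast_nonneg (α := ℝ) N) hq₀]

variable {k N : ℕ} (hk : 36 ≤ k)
include hk

lemma two_thirds_le_probRuns (h : 4 * (k : ℝ) ≤ 3 * (N * q)) :
    2 / 3 ≤ probRuns q N fun o => decide (k ≤ o.count true) := by
  have hk' : (36 : ℝ) ≤ k := mod_cast hk
  have hcheb := sq_mul_probRuns_le hq₀ hq₁ N (post := fun o => !decide (k ≤ o.count true))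
    (t := N * q / 4) fun o ho => by
      have hcount : ((o.count true : ℕ) : ℝ) < k := by simpa using ho
      rw [sub_sq_comm]
      exact pow_le_pow_left₀ (by positivity) (by linarith) 2
  have hfail : probRuns q N (fun o => !decide (k ≤ o.count true)) ≤ 1 / 3 :=
    le_of_mul_le_mul_left (hcheb.trans (by nlinarith)) (by nlinarith : 0 < (N * q / 4) ^ 2)
  linarith [probRuns_add_probRuns_not q N fun o => decide (k ≤ o.count true)]

lemma probRuns_le_one_third (h : 3 * (N * q) ≤ 2 * k) :
    (probRuns q N fun o => decide (k ≤ o.count true)) ≤ 1 / 3 := by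
  have hk' : (36 : ℝ) ≤ k := mod_cast hk
  have hcheb := sq_mul_probRuns_le hq₀ hq₁ N (post := fun o => decide (k ≤ o.count true))
    (t := k / 3) fun o ho => by
      have hcount : (k : ℝ) ≤ (o.count true : ℕ) := by simpa using ho
      exact pow_le_pow_left₀ (by positivity) (by linarith) 2
  exact le_of_mul_le_mul_left (hcheb.trans (by nlinarith)) (by positivity : 0 < ((k : ℝ) / 3) ^ 2)

end Chebyshev

/-! ### The threshold test as a machine -/

/-- The program that tests whether at least `k` symbols on the stack `false` satisfy `p`, and writes
the answer on the stack `true`. The first component of the variable is the number of symbols with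
`p` that are still missing, the second one tells whether a symbol was removed. -/
def threshold {A : Type} (p : A → Bool) (k : ℕ) :
    Frag (fun b => cond b Bool A) (Fin (k + 1) × Bool) :=
  .single (.pop false
    (fun v (o : Option A) =>
      (⟨v.1 - (o.elim false p).toNat, (Nat.sub_le _ _).trans_lt v.1.isLt⟩, o.isSome))
    (.branch Prod.snd (.goto fun _ => ())
      (.push true (fun v => (decide ((v.1 : ℕ) = 0) : Bool))
        (.load (fun _ => (Fin.last k, false)) .halt))))

lemma threshold_runs {A : Type} (p : A → Bool) {k : ℕ} (c : Fin (k + 1)) (b : Bool) (l : List A) :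
    (threshold p k).Runs (c, b) (onlyStack false l) (Fin.last k, false)
      (onlyStack true [decide ((c : ℕ) ≤ l.countP p)]) (l.length + 1) := by
  induction l generalizing c b with
  | nil =>
    refine ⟨1, by simp, .single (congrArg (TM2.Cfg.mk _ _) (funext fun i => ?_))⟩
    cases i <;> simp [onlyStack]
  | cons a l ih =>
    obtain ⟨t, ht, h⟩ := ih ⟨c - (p a).toNat, (Nat.sub_le _ _).trans_lt c.isLt⟩ true
    have hcount : decide ((c : ℕ) - (p a).toNat ≤ l.countP p) =
        decide ((c : ℕ) ≤ (a :: l).countP p) := by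
      cases hp : p a <;> simp [hp]
    rw [hcount] at h
    refine ⟨1 + t, by rw [List.length_cons]; lia,
      (Steps.single (congrArg (TM2.Cfg.mk _ _) (funext fun i => ?_))).trans h⟩
    cases i <;> rfl

theorem polyTime_threshold (k : ℕ) :
    Nonempty (TM2ComputableInPolyTime codePair Computability.encodeBool
      fun p => decide (k ≤ p.2.count true)) := by
  let isOne : Bool ⊕ Bool → Bool := Sum.elim (fun _ => false) id
  have : Finite (cond false Bool (Bool ⊕ Bool)) := inferInstanceAs (Finite (Bool ⊕ Bool))
  refine (threshold isOne k).polyTime (T := fun p => (codePair p).length + 1) (Fin.last k, false)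
    (k₀ := false) (k₁ := true) (.add .self (.const 1)) fun p => ?_
  have hcount : (codePair p).countP isOne = p.2.count true := by
    simp [codePair, isOne, List.countP_map, List.count, Function.comp_def]
  have run := threshold_runs isOne (Fin.last k) false (codePair p)
  rw [hcount] at run
  exact run

/-! ### The diluted circuit -/

/-- The embedding of a register of `m` qubits into one of `m + g + 1` qubits by `shiftWire`, which
leaves the qubit `1` and the last `g` qubits free. -/
def shiftEmb (m g : ℕ) : Fin m ↪ Fin (m + g + 1) where
  toFun i := ⟨shiftWire i, by unfold shiftWire; split_ifs <;> lia⟩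
  inj' i j h := by
    have hval : shiftWire i = shiftWire j := congrArg Fin.val h
    unfold shiftWire at hval
    split_ifs at hval <;> lia

/-- The qubit `1`, which controls the gates of the diluted circuit. -/
def ctrlQubit {m : ℕ} (hm : 0 < m) (g : ℕ) : Fin (m + g + 1) := ⟨1, by lia⟩

lemma shiftEmb_ne_ctrlQubit {m : ℕ} (hm : 0 < m) (g : ℕ) (i : Fin m) :
    shiftEmb m g i ≠ ctrlQubit hm g := fun h => by
  have hval : shiftWire i = 1 := congrArg Fin.val h
  unfold shiftWire at hval
  split_ifs at hval
  lia

/-- The circuit that rotates the control qubit by an angle of about `1 / N` and then runs the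
circuit `C` controlled by it. The register has an idle qubit for every gate of `C`, because the
number of gates that a circuit may have is bounded in terms of its number of qubits. -/
def dilutedCircuit (N : ℕ) (C : Circuit StdGate) : Circuit ExactGate where
  numQubits := C.numQubits + C.gates.length + 1
  pos := Nat.succ_pos _
  gates := rotation (ctrlQubit C.pos _) N :: C.gates.map fun g =>
    g.toExact.controlled (shiftEmb _ _) (ctrlQubit C.pos _) (shiftEmb_ne_ctrlQubit C.pos _)
      g.arity_toExact_le

lemma foldl_controlled_branchState {m n : ℕ} {f : Fin m ↪ Fin n} {c : Fin n} (hc : ∀ i, f i ≠ c)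
    (α β : ℂ) (gs : List (StdGate m)) (ψ : State m) :
    (gs.map fun g => (g.toExact.controlled f c hc g.arity_toExact_le).toGate).foldl
      (fun Ψ g => g.apply Ψ) (branchState f c α β ψ) =
    branchState f c α β ((gs.map StdGate.toGate).foldl (fun φ g => g.apply φ) ψ) := by
  induction gs generalizing ψ with
  | nil => rfl
  | cons g gs ih =>
    have hstep : (g.toExact.controlled f c hc g.arity_toExact_le).toGate.apply
        (branchState f c α β ψ) = branchState f c α β (g.toGate.apply ψ) := by
      rw [← g.toGate_toExact, ExactGate.toGate_controlled]
      exact Gate.controlled_apply_branchState hc _ _ _ _ _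
    rw [List.map_cons, List.map_cons, List.foldl_cons, List.foldl_cons, ← ih, hstep]

lemma finalState_dilutedCircuit_take (N : ℕ) (C : Circuit StdGate) (t : ℕ) :
    finalState (((dilutedCircuit N C).gates.take (t + 1)).map ExactGate.toGate) =
      branchState (shiftEmb _ _) (ctrlQubit C.pos _) (rotDiag N) (rotOff N)
        (finalState ((C.gates.take t).map StdGate.toGate)) := by
  change finalState (((rotation (ctrlQubit C.pos _) N :: C.gates.map _).take (t + 1)).map
    ExactGate.toGate) = _
  rw [List.take_succ_cons, List.map_cons, finalState, List.foldl_cons,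
    rotation_apply_zeroState (shiftEmb_ne_ctrlQubit C.pos _), ← List.map_take, List.map_map]
  exact foldl_controlled_branchState _ _ _ _ _

lemma accProb_dilutedCircuit (N : ℕ) (C : Circuit StdGate) :
    (dilutedCircuit N C).accProb (fun _ g => g.toGate) =
      C.accProb (fun _ g => g.toGate) / ((N : ℝ) ^ 2 + 1) := by
  have hfinal := finalState_dilutedCircuit_take N C C.gates.length
  have hlength : C.gates.length + 1 = (dilutedCircuit N C).gates.length := by
    simp [dilutedCircuit]
  rw [hlength, List.take_length, List.take_length] at hfinal
  have hfirst : (⟨0, (dilutedCircuit N C).pos⟩ : Fin (dilutedCircuit N C).numQubits) =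
      shiftEmb C.numQubits C.gates.length ⟨0, C.pos⟩ := rfl
  calc (dilutedCircuit N C).accProb (fun _ g => g.toGate)
      = probOne (branchState (shiftEmb _ _) (ctrlQubit C.pos _) (rotDiag N) (rotOff N)
          (finalState (C.gates.map StdGate.toGate))) (shiftEmb _ _ ⟨0, C.pos⟩) := by
        rw [Circuit.accProb, hfirst]
        exact congrArg (probOne · _) hfinal
    _ = ‖rotOff N‖ ^ 2 * C.accProb (fun _ g => g.toGate) :=
        probOne_branchState (shiftEmb_ne_ctrlQubit C.pos _) _ _ _ _
    _ = _ := by rw [norm_rotOff_sq]; ring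

lemma one_sub_overlap_dilutedCircuit_le (N : ℕ) (C : Circuit StdGate) (t : ℕ) :
    1 - ‖star (finalState (((dilutedCircuit N C).gates.take t).map ExactGate.toGate)) ⬝ᵥ
      zeroState (dilutedCircuit N C).numQubits‖ ^ 2 ≤ 1 / ((N : ℝ) ^ 2 + 1) := by
  rcases t with _ | t
  · have hself : star (zeroState (dilutedCircuit N C).numQubits) ⬝ᵥ zeroState _ = 1 := by
      rw [star_dotProduct_self, sum_norm_sq_zeroState, Complex.ofReal_one]
    rw [List.take_zero, List.map_nil, finalState, List.foldl_nil, hself, norm_one, one_pow,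
      sub_self]
    positivity
  · have hoverlap :
        star (finalState (((dilutedCircuit N C).gates.take (t + 1)).map ExactGate.toGate)) ⬝ᵥ
          zeroState (dilutedCircuit N C).numQubits = star (rotDiag N) := by
      rw [finalState_dilutedCircuit_take]
      exact star_branchState_dotProduct_zeroState (shiftEmb_ne_ctrlQubit C.pos _) _ _ _
    rw [hoverlap, norm_star, norm_rotDiag_sq]
    exact le_of_eq (by field_simp; ring)

lemma dilutedCircuit_mem_QC {ε : ℕ → ℝ} {N : ℕ} (hN : 0 < N) {C : Circuit StdGate}
    (hε : 1 / (N : ℝ) ≤ ε (dilutedCircuit N C).numQubits) : dilutedCircuit N C ∈ QC ε := by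
  intro t _
  have hunit := sum_norm_sq_finalState (((dilutedCircuit N C).gates.take t).map ExactGate.toGate)
  refine ⟨hunit, (traceDist_le_sqrt hunit (sum_norm_sq_zeroState _)).trans (le_trans ?_ hε)⟩
  rw [Real.sqrt_le_left (by positivity), div_pow, one_pow]
  exact (one_sub_overlap_dilutedCircuit_le N C t).trans
    (one_div_le_one_div_of_le (by positivity) (by simp))

section AccProb

variable {G : ℕ → Type} (den : ∀ n, G n → Gate n) (C : Circuit G)

lemma accProb_nonneg : 0 ≤ C.accProb den :=
  Finset.sum_nonneg fun x _ => by split_ifs <;> positivity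

lemma accProb_le_one : C.accProb den ≤ 1 := by
  rw [← sum_norm_sq_finalState (C.gates.map (den C.numQubits)), Circuit.accProb, probOne]
  refine Finset.sum_le_sum fun x _ => ?_
  split_ifs <;> simp

end AccProb

/-! ### The code of the diluted circuit -/

/-- The code of a matrix over the field `ℚ(ζ)`, as it occurs in the code of a gate. -/
def matCode {k : ℕ} (c : (Fin k → Bool) → (Fin k → Bool) → Fin 4 → ℚ) : List Bool :=
  (bitStrings k).flatMap fun x => (bitStrings k).flatMap fun y =>
    (List.ofFn (c x y)).flatMap codeRat

lemma ExactGate.code_eq {n : ℕ} (g : ExactGate n) :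
    g.code = codeNat g.arity ++ (List.ofFn fun i => (g.wires i : ℕ)).flatMap codeNat ++
      matCode g.coeff := rfl

lemma StdGate.code_controlled {m : ℕ} (hm : 0 < m) (k : ℕ) (g : StdGate m) :
    (g.toExact.controlled (shiftEmb m k) (ctrlQubit hm k) (shiftEmb_ne_ctrlQubit hm k)
      g.arity_toExact_le).code =
    g.ctrlCode (matCode (ctrlCoeff hadamardCoeff)) (matCode (ctrlCoeff phaseTCoeff))
      (matCode (ctrlCoeff cnotCoeff)) := by
  cases g <;>
    simp [ExactGate.code_eq, ExactGate.controlled, ExactGate.ofCoeff, toExact, List.ofFn_succ,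
      ctrlWires, ctrlQubit, wire1, wire2, shiftEmb, ctrlCode] <;>
    rfl

section CodeRat

variable {a b : ℕ} (hb : 0 < b) (hab : a.Coprime b)
include hb hab

lemma codeRat_div : codeRat ((a : ℚ) / b) = false :: (codeNat a ++ codeNat b) := by
  have hb' : (0 : ℤ) < b := mod_cast hb
  have hnum : ((a : ℚ) / b).num = a := by
    simpa using Rat.num_div_eq_of_coprime (a := a) hb' (by simpa using hab)
  have hden : (((a : ℚ) / b).den : ℤ) = b := by
    simpa using Rat.den_div_eq_of_coprime (a := a) hb' (by simpa using hab)
  have hneg : ¬((a : ℚ) / b < 0) := not_lt.2 (by positivity)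
  simp [codeRat, hnum, Int.natCast_inj.1 hden, hneg]

lemma codeRat_neg_div (ha : 0 < a) :
    codeRat (-(a : ℚ) / b) = true :: (codeNat a ++ codeNat b) := by
  have hb' : (0 : ℤ) < b := mod_cast hb
  have hnum : (-(a : ℚ) / b).num = -a := by
    simpa using Rat.num_div_eq_of_coprime (a := -a) hb' (by simpa using hab)
  have hden : ((-(a : ℚ) / b).den : ℤ) = b := by
    simpa using Rat.den_div_eq_of_coprime (a := -a) hb' (by simpa using hab)
  have hneg : -(a : ℚ) / b < 0 := by
    rw [neg_div]
    exact neg_lt_zero.2 (by positivity)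
  simp [codeRat, hnum, Int.natCast_inj.1 hden, hneg]

end CodeRat

/-- A string of bits as a text. -/
def bitText (w : List Bool) : List Symbol := w.map .bit

/-- The text of the code of a rational number with denominator `N ^ 2 + 1`, where `s` is the sign
bit and `a` the text of the numerator in unary. -/
def ratText (s : Bool) (a : List Symbol) : List Symbol :=
  .bit s :: (a ++ bitText [false] ++ .sq :: bitText [true, false])

/-- The text of the code of a diagonal entry of `rotMat N`. -/
def rotDiagText : List Symbol :=
  ratText false [.sq] ++ bitText (codeRat 0) ++ (ratText false [.num] ++ bitText (codeRat 0))

/-- The text of the code of an off-diagonal entry of `rotMat N`. -/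
def rotOffText : List Symbol :=
  ratText false (bitText [true]) ++ bitText (codeRat 0) ++
    (ratText true [.num] ++ bitText (codeRat 0))

/-- The text of the first gate of `dilutedCircuit N C`. -/
def rotText : List Symbol :=
  bitText (true :: (codeNat 1 ++ codeNat 1)) ++
    (rotDiagText ++ rotOffText ++ (rotOffText ++ rotDiagText))

lemma flatMap_val_bitText (N : ℕ) (w : List Bool) : (bitText w).flatMap (Symbol.val N) = w := by
  induction w with
  | nil => rfl
  | cons b w ih => exact congrArg (b :: ·) ih

lemma flatMap_val_ratText {N c : ℕ} (s : Bool) {a : List Symbol}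
    (ha : a.flatMap (Symbol.val N) = List.replicate c true) :
    (ratText s a).flatMap (Symbol.val N) = s :: (codeNat c ++ codeNat (N ^ 2 + 1)) := by
  simp [ratText, ha, flatMap_val_bitText, Symbol.val, codeNat, List.replicate_add]

lemma coprime_sq_add_one (N : ℕ) : N.Coprime (N ^ 2 + 1) := by simp [pow_two]

lemma flatMap_val_rotDiagText (N : ℕ) : rotDiagText.flatMap (Symbol.val N) =
    (List.ofFn ![(N : ℚ) ^ 2 / (N ^ 2 + 1), 0, (N : ℚ) / (N ^ 2 + 1), 0]).flatMap codeRat := by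
  have hsq := codeRat_div (a := N ^ 2) (b := N ^ 2 + 1) (by simp) (by simp)
  have hnum := codeRat_div (by positivity) (coprime_sq_add_one N)
  push_cast at hsq hnum
  simp only [rotDiagText, List.flatMap_append, flatMap_val_bitText]
  rw [flatMap_val_ratText (c := N ^ 2) false (by simp [Symbol.val]),
    flatMap_val_ratText (c := N) false (by simp [Symbol.val])]
  simp [List.ofFn_succ, hsq, hnum]

lemma flatMap_val_rotOffText {N : ℕ} (hN : 0 < N) : rotOffText.flatMap (Symbol.val N) =
    (List.ofFn ![1 / ((N : ℚ) ^ 2 + 1), 0, -(N : ℚ) / (N ^ 2 + 1), 0]).flatMap codeRat := by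
  have hone := codeRat_div (a := 1) (b := N ^ 2 + 1) (by simp) (by simp)
  have hnum := codeRat_neg_div (by positivity) (coprime_sq_add_one N) hN
  push_cast [one_div] at hone hnum
  simp only [rotOffText, List.flatMap_append, flatMap_val_bitText]
  rw [flatMap_val_ratText (c := 1) false (flatMap_val_bitText N [true]),
    flatMap_val_ratText (c := N) true (by simp [Symbol.val])]
  simp [List.ofFn_succ, hone, hnum]

lemma bitStrings_one : bitStrings 1 = [fun _ => false, fun _ => true] := by
  have hrange : List.range (2 ^ 1) = [0, 1] := rfl
  rw [bitStrings, hrange]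
  simp only [List.map_cons, List.map_nil, List.cons.injEq, and_true]
  constructor <;> funext i <;> fin_cases i <;> rfl

lemma flatMap_val_rotText {n : ℕ} (c : Fin n) (hc : (c : ℕ) = 1) {N : ℕ} (hN : 0 < N) :
    rotText.flatMap (Symbol.val N) = true :: (rotation c N).code := by
  have hwires : (List.ofFn fun i => ((rotation c N).wires i : ℕ)).flatMap codeNat = codeNat 1 := by
    change (List.ofFn fun _ : Fin 1 => (c : ℕ)).flatMap codeNat = _
    simp [hc]
  have hmat : matCode (rotation c N).coeff = rotDiagText.flatMap (Symbol.val N) ++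
      rotOffText.flatMap (Symbol.val N) ++ (rotOffText.flatMap (Symbol.val N) ++
        rotDiagText.flatMap (Symbol.val N)) := by
    change matCode (rotCoeff N) = _
    simp [matCode, bitStrings_one, rotCoeff, flatMap_val_rotDiagText, flatMap_val_rotOffText hN]
  rw [ExactGate.code_eq, hwires, hmat]
  simp only [rotText, List.flatMap_append, flatMap_val_bitText]
  rfl

lemma code_dilutedCircuit {N : ℕ} (hN : 0 < N) (C : Circuit StdGate) :
    (dilutedCircuit N C).code (fun _ g => g.code) =
      codeNat (C.numQubits + C.gates.length + 1) ++ (rotText.flatMap (Symbol.val N) ++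
        (C.gates.flatMap (fun g => true :: g.ctrlCode (matCode (ctrlCoeff hadamardCoeff))
          (matCode (ctrlCoeff phaseTCoeff)) (matCode (ctrlCoeff cnotCoeff))) ++ [false])) := by
  rw [Circuit.code, flatMap_val_rotText (ctrlQubit C.pos C.gates.length) rfl hN]
  simp only [dilutedCircuit, List.flatMap_cons, List.flatMap_map, StdGate.code_controlled,
    List.append_assoc, List.cons_append]

lemma polyTime_dilutedCircuit {circ : List Bool → Circuit StdGate}
    (h : TM2ComputableInPolyTime (id : List Bool → List Bool)
      (Circuit.code fun _ g => g.code) circ) (j : ℕ) :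
    Nonempty (TM2ComputableInPolyTime (id : List Bool → List Bool)
      (Circuit.code fun _ g => g.code)
      fun x => dilutedCircuit ((x.length + 2) ^ j) (circ x)) := by
  refine polyTime_of_wrap h Reg.inp .aux .out (Prog.prepare j)
    (Prog.translate (matCode (ctrlCoeff hadamardCoeff)) (matCode (ctrlCoeff phaseTCoeff))
      (matCode (ctrlCoeff cnotCoeff)) rotText)
    (fun x => Regs.stk { num := (x.length + 2) ^ j, sq := ((x.length + 2) ^ j) ^ 2 })
    (Prog.prepare_doesPoly j) ?_
  simp only [Regs.update_aux, Regs.onlyStack_out,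
    code_dilutedCircuit (N := (_ + 2) ^ j) (by positivity)]
  exact Prog.translate_doesPoly _ _ _ _ _ circ

/-! ### Polynomially small families -/

lemma numQubits_add_length_le (C : Circuit StdGate) :
    C.numQubits + C.gates.length + 1 ≤ (C.code fun _ g => g.code).length := by
  have hgates : C.gates.length ≤ (C.gates.flatMap fun g => true :: g.code).length := by
    rw [List.length_flatMap]
    simp
  simp only [Circuit.code, codeNat, List.length_append, List.length_replicate,
    List.length_singleton]
  lia

namespace PolynomiallySmall

variable {ε : ℕ → ℝ} (hε : PolynomiallySmall ε)
include hε

lemma exists_one_div_le : ∃ c k : ℕ, ∀ n : ℕ, 1 / ε n ≤ ((c * (n + 1) ^ k : ℕ) : ℝ) := by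
  obtain ⟨-, p, hp⟩ := hε
  let q : Polynomial ℝ := (Polynomial.X + Polynomial.C 1) ^ p.natDegree
  have hq : p.degree ≤ q.degree := by
    rw [Polynomial.degree_pow, Polynomial.degree_X_add_C, nsmul_one]
    exact Polynomial.degree_le_natDegree
  have hbound : (fun n : ℕ => 1 / ε n) =O[atTop] fun n : ℕ => ((n : ℝ) + 1) ^ p.natDegree := by
    simpa [q, Function.comp_def] using hp.trans
      ((p.isBigO_atTop_of_degree_le q hq).comp_tendsto tendsto_natCast_atTop_atTop)
  obtain ⟨c, hc⟩ := (isBigO_nat_atTop_iff fun n h => absurd h (by positivity)).1 hbound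
  refine ⟨⌈c⌉₊, p.natDegree, fun n => ?_⟩
  calc 1 / ε n ≤ ‖1 / ε n‖ := Real.le_norm_self _
    _ ≤ c * ‖((n : ℝ) + 1) ^ p.natDegree‖ := hc n
    _ ≤ ((⌈c⌉₊ * (n + 1) ^ p.natDegree : ℕ) : ℝ) := by
      rw [Real.norm_of_nonneg (by positivity)]
      push_cast
      gcongr
      exact Nat.le_ceil c

lemma exists_one_div_pow_le {ι : Type*} {size n : ι → ℕ} (hn : PolyBounded size n)
    (hpos : ∀ i, 1 ≤ n i) : ∃ j, ∀ i, 1 / (((size i + 2) ^ j : ℕ) : ℝ) ≤ ε (n i) := by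
  obtain ⟨c, k, hε_le⟩ := hε.exists_one_div_le
  obtain ⟨j, hj⟩ := ((PolyBounded.const c).mul ((hn.add (.const 1)).pow k)).exists_le_pow
  refine ⟨j, fun i => ?_⟩
  rw [one_div_le (by positivity) (hε.1 _ (hpos i))]
  exact (hε_le (n i)).trans (mod_cast hj i)

end PolynomiallySmall

lemma eval_mul_accProb_dilutedCircuit (c j n : ℕ) (C : Circuit StdGate) :
    (((Polynomial.C c * (((Polynomial.X + 2) ^ j) ^ 2 + 1) : Polynomial ℕ).eval n : ℕ) : ℝ) *
      ((dilutedCircuit ((n + 2) ^ j) C).accProb fun _ g => g.toGate) =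
    c * C.accProb fun _ g => g.toGate := by
  have hN : (((n + 2) ^ j : ℕ) : ℝ) ^ 2 + 1 ≠ 0 := by positivity
  rw [accProb_dilutedCircuit]
  simp only [Polynomial.eval_mul, Polynomial.eval_add, Polynomial.eval_pow, Polynomial.eval_C,
    Polynomial.eval_X, Polynomial.eval_ofNat, Polynomial.eval_one]
  push_cast at hN ⊢
  field_simp

end SmallQC

end

/-- For every polynomially small `ε`, the restricted quantum computer `QC_ε` can solve every
problem in BQP in polynomial time. -/
theorem mainTheorem1 (ε : ℕ → ℝ) (hε : SmallQC.PolynomiallySmall ε)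
    (yes no : Set (List Bool)) (hBQP : SmallQC.InBQP yes no) :
    SmallQC.SolvableByQC ε yes no := by
  obtain ⟨circ, ⟨hcirc⟩, hyes, hno⟩ := hBQP
  have hqubits : SmallQC.PolyBounded List.length
      fun x => (circ x).numQubits + (circ x).gates.length + 1 :=
    (SmallQC.polyBounded_length_output hcirc).mono fun x =>
      SmallQC.numQubits_add_length_le (circ x)
  obtain ⟨j, hj⟩ := hε.exists_one_div_pow_le hqubits fun x => Nat.le_add_left 1 _
  refine ⟨fun x => SmallQC.dilutedCircuit ((x.length + 2) ^ j) (circ x), Polynomial.X,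
    Polynomial.C 72 * (((Polynomial.X + 2) ^ j) ^ 2 + 1), fun p => decide (36 ≤ p.2.count true),
    SmallQC.polyTime_dilutedCircuit hcirc j, SmallQC.polyTime_threshold 36,
    fun x => SmallQC.dilutedCircuit_mem_QC (by positivity) (hj x),
    fun x => by simp [SmallQC.dilutedCircuit], fun x hx => ?_, fun x hx => ?_⟩
  · refine SmallQC.two_thirds_le_probRuns (SmallQC.accProb_nonneg _ _)
      (SmallQC.accProb_le_one _ _) le_rfl ?_
    rw [SmallQC.eval_mul_accProb_dilutedCircuit]
    push_cast
    linarith [hyes x hx]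
  · refine SmallQC.probRuns_le_one_third (SmallQC.accProb_nonneg _ _)
      (SmallQC.accProb_le_one _ _) le_rfl ?_
    rw [SmallQC.eval_mul_accProb_dilutedCircuit]
    push_cast
    linarith [hno x hx]
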